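/- Let $q$ be a prime power and let $H=\mathbb{F}_{q^2}(x,y)$, where $y^q+y=x^{q+1}$, be the Hermitian function field over $\mathbb{F}_{q^2}$. Let $\mathcal{P}=\{P_0,\dots,P_{n-1}\}$ be the (finite) set of rational places of $H$, that is, its places of degree one, and let $v_i$ be the normalized discrete valuation of $P_i$. Let $\mathcal{O}_{\mathcal P}^*$ be the group of all nonzero $f\in H$ whose divisor has support contained in $\mathcal{P}$, and let $$L_{\mathcal P}=\{(v_0(f),\dots,v_{n-1}(f)) : f\in\mathcal{O}_{\mathcal P}^*\}\subset\mathbb{Z}^n\subset\mathbb{R}^n ,$$ where $\mathbb{R}^n$ carries the Euclidean norm. Let $d(L_{\mathcal P})$ be the infimum of the norms of the nonzero vectors of $L_{\mathcal P}$; a minimal vector is a nonzero vector of $L_{\mathcal P}$ of norm $d(L_{\mathcal P})$. Then the number of minimal vectors of $L_{\mathcal P}$ is finite and at least $$q^7-q^5+q^4-q^2 .$$ Consequently the kissing number of $L_{\mathcal P}$ (the number of balls touching a given ball in the packing by the closed balls of radius $d(L_{\mathcal P})/2$ centred at the points of $L_{\mathcal P}$) is finite and at least $q^7-q^5+q^4-q^2$.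 -/

import Mathlib

open scoped WithZero

namespace FunctionFieldLattice

/-! ## Places of a field extension `F / K` -/

/-- A place of `F / K`, given by its normalized discrete valuation: a surjective (that is,
normalized) valuation of `F` with value group `ℤ` (written multiplicatively, so that the value of
`f` is `exp (-v_P(f))`) which is trivial on the constant field `K`. -/
structure Place (K F : Type*) [Field K] [Field F] [Algebra K F] where
  valuation : Valuation F ℤᵐ⁰
  surjective : Function.Surjective valuation
  trivial_on_constants : ∀ c : K, c ≠ 0 → valuation (algebraMap K F c) = 1

namespace Place

variable {K F : Type*} [Field K] [Field F] [Algebra K F]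

/-- The normalized discrete valuation `v_P(f) ∈ ℤ` of a nonzero function `f`. -/
noncomputable def ord (P : Place K F) (f : Fˣ) : ℤ :=
  -WithZero.log (P.valuation (f : F))

theorem valuation_algebraMap_le_one (P : Place K F) (c : K) :
    P.valuation (algebraMap K F c) ≤ 1 := by
  by_cases hc : c = 0
  · simp [hc]
  · exact (P.trivial_on_constants c hc).le

/-- The inclusion of the constant field into the valuation ring `𝒪_P`. -/
noncomputable def constants (P : Place K F) : K →+* P.valuation.valuationSubring :=
  (algebraMap K F).codRestrict P.valuation.valuationSubring
    fun c => (P.valuation.mem_valuationSubring_iff _).2 (P.valuation_algebraMap_le_one c)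

/-- The degree of a place `P`: the dimension over `K` of the residue field `𝒪_P / P`. -/
noncomputable def degree (P : Place K F) : ℕ :=
  letI : Algebra K (IsLocalRing.ResidueField P.valuation.valuationSubring) :=
    ((IsLocalRing.residue P.valuation.valuationSubring).comp P.constants).toAlgebra
  Module.finrank K (IsLocalRing.ResidueField P.valuation.valuationSubring)

/-- A rational place is a place of degree one. -/
def IsRational (P : Place K F) : Prop :=
  P.degree = 1

theorem ext_valuation {P Q : Place K F} (h : ∀ f, P.valuation f = Q.valuation f) : P = Q := by
  cases P; cases Q
  congr
  exact Valuation.ext h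

theorem IsRational.exists_const {P : Place K F} (hP : P.IsRational) {f : F}
    (hf : P.valuation f ≤ 1) : ∃ c : K, P.valuation (f - algebraMap K F c) < 1 := by
  let : Algebra K (IsLocalRing.ResidueField P.valuation.valuationSubring) :=
    ((IsLocalRing.residue P.valuation.valuationSubring).comp P.constants).toAlgebra
  have h1 : Module.finrank K (IsLocalRing.ResidueField P.valuation.valuationSubring) = 1 := hP
  let g : P.valuation.valuationSubring := ⟨f, (P.valuation.mem_valuationSubring_iff _).2 hf⟩
  obtain ⟨c, hc⟩ := (finrank_eq_one_iff_of_nonzero' (K := K) (1 : IsLocalRing.ResidueField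
    P.valuation.valuationSubring) one_ne_zero).1 h1 (IsLocalRing.residue _ g)
  refine ⟨c, ?_⟩
  rw [Algebra.smul_def, mul_one] at hc
  have hc' : IsLocalRing.residue P.valuation.valuationSubring (P.constants c) =
      IsLocalRing.residue _ g := hc
  have h0 : IsLocalRing.residue P.valuation.valuationSubring (g - P.constants c) = 0 := by
    rw [map_sub, hc', sub_self]
  rw [IsLocalRing.residue_eq_zero_iff] at h0
  by_contra hlt
  rw [not_lt] at hlt
  have hle : P.valuation (f - algebraMap K F c) ≤ 1 :=
    (P.valuation.mem_valuationSubring_iff _).1 (g - P.constants c).2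
  have heq : P.valuation (f - algebraMap K F c) = 1 := le_antisymm hle hlt
  have hne : f - algebraMap K F c ≠ 0 := by
    intro h; rw [h, map_zero] at heq; exact zero_ne_one heq
  refine (IsLocalRing.mem_maximalIdeal _).1 h0 ?_
  refine IsUnit.of_mul_eq_one (b := ⟨(f - algebraMap K F c)⁻¹, (P.valuation.mem_valuationSubring_iff _).2 ?_⟩) ?_
  · rw [map_inv₀, heq, inv_one]
  · exact Subtype.ext (mul_inv_cancel₀ hne)

end Place

/-- The set of rational places of `F / K`, as a type. -/
abbrev RationalPlace (K F : Type*) [Field K] [Field F] [Algebra K F] : Type _ :=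
  {P : Place K F // P.IsRational}

/-! ## The lattice of a function field -/

section Lattice

variable (K F : Type*) [Field K] [Field F] [Algebra K F]

/-- The group `𝒪_𝒫^*` of all nonzero functions whose divisor is supported in the set `𝒫` of
rational places. -/
noncomputable def supportedUnits : Subgroup Fˣ where
  carrier := {f | ∀ P : Place K F, ¬ P.IsRational → P.ord f = 0}
  one_mem' := by intro P _; simp [Place.ord]
  mul_mem' := by
    intro f g hf hg P hP
    have h1 := hf P hP
    have h2 := hg P hP
    have hf0 : P.valuation (f : F) ≠ 0 := (P.valuation.ne_zero_iff).2 f.ne_zero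
    have hg0 : P.valuation (g : F) ≠ 0 := (P.valuation.ne_zero_iff).2 g.ne_zero
    simp only [Place.ord, Units.val_mul, map_mul] at *
    rw [WithZero.log_mul hf0 hg0]
    omega
  inv_mem' := by
    intro f hf P hP
    have h1 := hf P hP
    simp only [Place.ord, Units.val_inv_eq_inv_val, map_inv₀, WithZero.log_inv] at *
    omega

/-- The homomorphism `φ_𝒫(f) = (v_P(f))_{P ∈ 𝒫}`, with values in the Euclidean space `ℝ^𝒫`. -/
noncomputable def divisorHom :
    Additive (supportedUnits K F) →+ EuclideanSpace ℝ (RationalPlace K F) where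
  toFun f := WithLp.toLp 2 fun P => ((P.1.ord (f.toMul : Fˣ) : ℤ) : ℝ)
  map_zero' := by
    ext P
    simp [Place.ord]
  map_add' f g := by
    ext P
    have hf0 : P.1.valuation ((f.toMul : Fˣ) : F) ≠ 0 :=
      (P.1.valuation.ne_zero_iff).2 (f.toMul : Fˣ).ne_zero
    have hg0 : P.1.valuation ((g.toMul : Fˣ) : F) ≠ 0 :=
      (P.1.valuation.ne_zero_iff).2 (g.toMul : Fˣ).ne_zero
    simp only [Place.ord, toMul_add, Subgroup.coe_mul, Units.val_mul, map_mul,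
      WithZero.log_mul hf0 hg0, PiLp.add_apply]
    push_cast
    ring

/-- The function field lattice `L_𝒫`, the image of `φ_𝒫`. -/
noncomputable def lattice : AddSubgroup (EuclideanSpace ℝ (RationalPlace K F)) :=
  (divisorHom K F).range

end Lattice

/-! ## Minimal vectors and kissing number -/

section Kissing

variable {E : Type*} [NormedAddCommGroup E]

/-- The minimum distance `d(L)`: the infimum of the norms of the nonzero vectors of `L`. -/
noncomputable def minDist (L : AddSubgroup E) : ℝ :=
  sInf {r : ℝ | ∃ v ∈ L, v ≠ 0 ∧ ‖v‖ = r}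

/-- The minimal vectors of `L`: the nonzero vectors of `L` of norm `d(L)`. -/
def minimalVectors (L : AddSubgroup E) : Set E :=
  {v | v ∈ L ∧ v ≠ 0 ∧ ‖v‖ = minDist L}

/-- The kissing number of `L`: the number of other balls that touch the ball around the origin in
the packing by the closed balls of radius `d(L) / 2` around the points of `L`. -/
noncomputable def kissingNumber (L : AddSubgroup E) : ℕ :=
  Set.ncard {v : E | v ∈ L ∧ v ≠ 0 ∧
    (Metric.closedBall v (minDist L / 2) ∩ Metric.closedBall 0 (minDist L / 2)).Nonempty}

end Kissing

/-! ## The Hermitian function field -/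

section Hermitian

open Polynomial

variable (K : Type*) [Field K] (q : ℕ)

/-- The polynomial `x ^ (q + 1) - (y ^ q + y)` in `K[y][x]`; the outer variable is `x`. -/
noncomputable def hermitianPolynomial : K[X][X] :=
  X ^ (q + 1) - C (X ^ q + X)

/-- The coordinate ring `K[x, y] / (y ^ q + y - x ^ (q + 1))` of the affine Hermitian curve. -/
abbrev HermitianCoordinateRing : Type _ :=
  AdjoinRoot (hermitianPolynomial K q)

theorem irreducible_hermitianPolynomial (hq : 2 ≤ q) : Irreducible (hermitianPolynomial K q) := by
  have hdeg : (hermitianPolynomial K q).natDegree = q + 1 := by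
    unfold hermitianPolynomial
    exact natDegree_X_pow_sub_C
  have hmonic : (hermitianPolynomial K q).Monic := by
    unfold hermitianPolynomial
    exact monic_X_pow_sub_C _ (by omega)
  refine irreducible_of_eisenstein_criterion (P := Ideal.span {(X : K[X])})
    ((Ideal.span_singleton_prime X_ne_zero).2 prime_X) ?_ ?_ ?_ ?_ hmonic.isPrimitive
  · rw [hmonic.leadingCoeff, Ideal.mem_span_singleton, X_dvd_iff]
    simp
  · intro n hn
    rw [degree_eq_natDegree hmonic.ne_zero, hdeg] at hn
    have hn' : n < q + 1 := by exact_mod_cast hn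
    rw [Ideal.mem_span_singleton, X_dvd_iff, hermitianPolynomial, coeff_sub, coeff_X_pow,
      if_neg (by omega), coeff_C]
    split_ifs
    · have : q ≠ 0 := by omega
      simp [this.symm]
    · simp
  · rw [← natDegree_pos_iff_degree_pos, hdeg]
    omega
  · rw [Ideal.span_singleton_pow, Ideal.mem_span_singleton, X_pow_dvd_iff]
    intro h
    have h1 := h 1 (by norm_num)
    simp only [hermitianPolynomial, coeff_sub, coeff_X_pow, coeff_C] at h1
    have h2 : (1 : ℕ) ≠ q := by omega
    simp [h2] at h1

theorem two_le_of_isPrimePow [hq : Fact (IsPrimePow q)] : 2 ≤ q := hq.out.two_le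

instance [Fact (IsPrimePow q)] : IsDomain (HermitianCoordinateRing K q) :=
  AdjoinRoot.isDomain_of_prime (irreducible_hermitianPolynomial K q (two_le_of_isPrimePow q)).prime

/-- The Hermitian function field `H = K(x, y)`, where `y ^ q + y = x ^ (q + 1)`. It is the function
field of the Hermitian curve when `K` has `q ^ 2` elements. -/
abbrev HermitianField [Fact (IsPrimePow q)] : Type _ :=
  FractionRing (HermitianCoordinateRing K q)

/-- The generator `x` of the Hermitian function field. -/
noncomputable def hermitianX [Fact (IsPrimePow q)] : HermitianField K q :=
  algebraMap (HermitianCoordinateRing K q) (HermitianField K q)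
    (AdjoinRoot.root (hermitianPolynomial K q))

/-- The generator `y` of the Hermitian function field. -/
noncomputable def hermitianY [Fact (IsPrimePow q)] : HermitianField K q :=
  algebraMap (HermitianCoordinateRing K q) (HermitianField K q)
    (AdjoinRoot.of (hermitianPolynomial K q) X)

theorem eval₂_hermitianPolynomial {S : Type*} [CommRing S] (φ : K[X] →+* S) (ξ : S) :
    (hermitianPolynomial K q).eval₂ φ ξ = ξ ^ (q + 1) - φ (X ^ q + X) := by
  rw [hermitianPolynomial, eval₂_sub, eval₂_pow, eval₂_X, eval₂_C]

theorem hermitian_equation [Fact (IsPrimePow q)] :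
    hermitianY K q ^ q + hermitianY K q = hermitianX K q ^ (q + 1) := by
  have h : AdjoinRoot.root (hermitianPolynomial K q) ^ (q + 1) =
      AdjoinRoot.of (hermitianPolynomial K q) (X ^ q + X) := by
    have h0 : (hermitianPolynomial K q).eval₂ (AdjoinRoot.of (hermitianPolynomial K q))
        (AdjoinRoot.root (hermitianPolynomial K q)) = 0 := AdjoinRoot.eval₂_root _
    rw [eval₂_hermitianPolynomial] at h0
    exact sub_eq_zero.1 h0
  rw [map_add, map_pow] at h
  have h' := congrArg (algebraMap (HermitianCoordinateRing K q) (HermitianField K q)) h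
  rw [map_pow, map_add, map_pow] at h'
  exact h'.symm

theorem adjoin_hermitian_eq_top [Fact (IsPrimePow q)] :
    IntermediateField.adjoin K {hermitianX K q, hermitianY K q} = ⊤ := by
  set S := IntermediateField.adjoin K {hermitianX K q, hermitianY K q} with hS
  have hx : hermitianX K q ∈ S := IntermediateField.subset_adjoin _ _ (by simp)
  have hy : hermitianY K q ∈ S := IntermediateField.subset_adjoin _ _ (by simp)
  have hof : ∀ p : K[X], algebraMap (HermitianCoordinateRing K q) (HermitianField K q)
      (AdjoinRoot.of (hermitianPolynomial K q) p) ∈ S := by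
    intro p
    induction p using Polynomial.induction_on' with
    | add p r hp hr => rw [map_add, map_add]; exact S.add_mem hp hr
    | monomial n a =>
      rw [← C_mul_X_pow_eq_monomial, map_mul, map_mul, map_pow, map_pow]
      exact S.mul_mem (S.algebraMap_mem a) (S.pow_mem hy n)
  have hR : ∀ r : HermitianCoordinateRing K q,
      algebraMap (HermitianCoordinateRing K q) (HermitianField K q) r ∈ S := by
    intro r
    obtain ⟨p, rfl⟩ := AdjoinRoot.mk_surjective r
    induction p using Polynomial.induction_on' with
    | add p r hp hr => rw [map_add, map_add]; exact S.add_mem hp hr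
    | monomial n a =>
      rw [← C_mul_X_pow_eq_monomial, map_mul, map_mul, map_pow, map_pow, AdjoinRoot.mk_C,
        AdjoinRoot.mk_X]
      exact S.mul_mem (hof a) (S.pow_mem hx n)
  rw [eq_top_iff]
  intro f _
  obtain ⟨a, b, _, rfl⟩ := IsFractionRing.div_surjective (A := HermitianCoordinateRing K q) f
  exact S.div_mem (hR a) (hR b)

end Hermitian

/-! ## Finiteness of the set of rational places -/

section Finiteness

variable {K F : Type*} [Field K] [Field F] [Algebra K F]

theorem exists_const_add_of_mem_adjoin {t τ a : F} (ha : a ∈ Algebra.adjoin K {t, τ}) :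
    ∃ c : K, ∃ b ∈ Algebra.adjoin K {t, τ}, ∃ d ∈ Algebra.adjoin K {t, τ},
      a = algebraMap K F c + t * b + τ * d := by
  have ht : t ∈ Algebra.adjoin K {t, τ} := Algebra.subset_adjoin (by simp)
  have hτ : τ ∈ Algebra.adjoin K {t, τ} := Algebra.subset_adjoin (by simp)
  induction ha using Algebra.adjoin_induction with
  | mem x hx =>
    rcases hx with rfl | rfl
    · exact ⟨0, 1, one_mem _, 0, zero_mem _, by simp⟩
    · exact ⟨0, 0, zero_mem _, 1, one_mem _, by simp⟩
  | algebraMap r => exact ⟨r, 0, zero_mem _, 0, zero_mem _, by simp⟩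
  | add x y _ _ hx hy =>
    obtain ⟨c, b, hb, d, hd, rfl⟩ := hx
    obtain ⟨c', b', hb', d', hd', rfl⟩ := hy
    exact ⟨c + c', b + b', add_mem hb hb', d + d', add_mem hd hd', by rw [map_add]; ring⟩
  | mul x y _ hy' hx hy =>
    obtain ⟨c, b, hb, d, hd, rfl⟩ := hx
    obtain ⟨c', b', hb', d', hd', hy1⟩ := hy
    refine ⟨c * c', algebraMap K F c * b' + b * y,
      add_mem (mul_mem (Subalgebra.algebraMap_mem _ c) hb') (mul_mem hb hy'),
      algebraMap K F c * d' + d * y,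
      add_mem (mul_mem (Subalgebra.algebraMap_mem _ c) hd') (mul_mem hd hy'), ?_⟩
    have : (algebraMap K F c + t * b + τ * d) * y =
      algebraMap K F c * y + t * (b * y) + τ * (d * y) := by ring
    rw [this, map_mul]
    nth_rewrite 1 [hy1]
    ring

theorem Place.valuation_const_add (P : Place K F) {t τ b d : F} {c : K} (hc : c ≠ 0)
    (hb : P.valuation b ≤ 1) (hd : P.valuation d ≤ 1)
    (ht : P.valuation t < 1) (hτ : P.valuation τ < 1) :
    P.valuation (algebraMap K F c + t * b + τ * d) = 1 := by
  have h1 : P.valuation (t * b) < 1 := by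
    rw [map_mul]; exact mul_lt_one_of_lt_of_le ht hb
  have h2 : P.valuation (τ * d) < 1 := by
    rw [map_mul]; exact mul_lt_one_of_lt_of_le hτ hd
  have h3 : P.valuation (t * b + τ * d) < 1 := P.valuation.map_add_lt h1 h2
  rw [add_assoc, Valuation.map_add_eq_of_lt_left]
  · exact P.trivial_on_constants c hc
  · rw [P.trivial_on_constants c hc]; exact h3

theorem Place.valuation_le_one_of_mem_adjoin (P : Place K F) {t τ a : F}
    (ht : P.valuation t ≤ 1) (hτ : P.valuation τ ≤ 1)
    (ha : a ∈ Algebra.adjoin K {t, τ}) : P.valuation a ≤ 1 := by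
  induction ha using Algebra.adjoin_induction with
  | mem x hx =>
    rcases hx with rfl | rfl <;> assumption
  | algebraMap r => exact P.valuation_algebraMap_le_one r
  | add x y _ _ hx hy => exact P.valuation.map_add_le hx hy
  | mul x y _ _ hx hy => rw [map_mul]; exact mul_le_one' hx hy

theorem exists_local_form {q : ℕ} (hq : 2 ≤ q) {t τ : F} (h : τ ^ q + τ = t ^ (q + 1))
    (P : Place K F) (ht : P.valuation t < 1) (hτ : P.valuation τ < 1) (n : ℕ) :
    ∀ a ∈ Algebra.adjoin K {t, τ}, a ≠ 0 → WithZero.exp (-(n : ℤ)) ≤ P.valuation a →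
      ∃ m : ℕ, ∃ c : K, c ≠ 0 ∧ ∃ b ∈ Algebra.adjoin K {t, τ}, ∃ d ∈ Algebra.adjoin K {t, τ},
        (1 + τ ^ (q - 1)) ^ m * a = t ^ m * (algebraMap K F c + t * b + τ * d) := by
  have htm : t ∈ Algebra.adjoin K {t, τ} := Algebra.subset_adjoin (by simp)
  have hτm : τ ∈ Algebra.adjoin K {t, τ} := Algebra.subset_adjoin (by simp)
  have hτ1 : τ * (1 + τ ^ (q - 1)) = t ^ (q + 1) := by
    rw [← h, mul_add, mul_one, ← pow_succ', Nat.sub_add_cancel (by omega), add_comm]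
  have hs : P.valuation (1 + τ ^ (q - 1)) = 1 := by
    rw [Valuation.map_add_eq_of_lt_left, map_one]
    rw [map_one, map_pow]
    exact pow_lt_one₀ zero_le hτ (by omega)
  induction n with
  | zero =>
    intro a ha _ hval
    obtain ⟨c, b, hb, d, hd, rfl⟩ := exists_const_add_of_mem_adjoin ha
    refine ⟨0, c, ?_, b, hb, d, hd, by simp⟩
    rintro rfl
    have h1 : P.valuation (t * b) < 1 := by
      rw [map_mul]
      exact mul_lt_one_of_lt_of_le ht (P.valuation_le_one_of_mem_adjoin ht.le hτ.le hb)
    have h2 : P.valuation (τ * d) < 1 := by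
      rw [map_mul]
      exact mul_lt_one_of_lt_of_le hτ (P.valuation_le_one_of_mem_adjoin ht.le hτ.le hd)
    have h3 : P.valuation (t * b + τ * d) < 1 := P.valuation.map_add_lt h1 h2
    rw [map_zero, zero_add] at hval
    simp only [Nat.cast_zero, neg_zero, WithZero.exp_zero] at hval
    exact absurd h3 (not_lt.2 hval)
  | succ n ih =>
    intro a ha ha0 hval
    obtain ⟨c, b, hb, d, hd, hform⟩ := exists_const_add_of_mem_adjoin ha
    by_cases hc : c = 0
    · subst hc
      set a' := (1 + τ ^ (q - 1)) * b + t ^ q * d with ha'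
      have hmem : a' ∈ Algebra.adjoin K {t, τ} :=
        add_mem (mul_mem (add_mem (one_mem _) (pow_mem hτm _)) hb) (mul_mem (pow_mem htm _) hd)
      have heq : (1 + τ ^ (q - 1)) * a = t * a' := by
        rw [hform, map_zero, zero_add, ha']
        linear_combination d * hτ1
      have hveq : P.valuation a = P.valuation t * P.valuation a' := by
        rw [← map_mul, ← heq, map_mul, hs, one_mul]
      have ha'0 : a' ≠ 0 := by
        intro h0
        rw [h0, map_zero, mul_zero] at hveq
        exact ha0 ((P.valuation.zero_iff).1 hveq)
      have ht0 : P.valuation t ≠ 0 := by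
        intro h0
        rw [h0, zero_mul] at hveq
        exact ha0 ((P.valuation.zero_iff).1 hveq)
      have hv0 : P.valuation a' ≠ 0 := (P.valuation.ne_zero_iff).2 ha'0
      have hle : WithZero.exp (-(n : ℤ)) ≤ P.valuation a' := by
        rw [hveq, ← WithZero.exp_log ht0, ← WithZero.exp_log hv0, ← WithZero.exp_add,
          WithZero.exp_le_exp] at hval
        rw [← WithZero.exp_log ht0, ← WithZero.exp_zero, WithZero.exp_lt_exp] at ht
        rw [← WithZero.exp_log hv0, WithZero.exp_le_exp]
        push_cast at hval
        omega
      obtain ⟨m, c, hc, b', hb', d', hd', hm⟩ := ih a' hmem ha'0 hle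
      refine ⟨m + 1, c, hc, b', hb', d', hd', ?_⟩
      rw [pow_succ, mul_assoc, heq, mul_left_comm, hm]
      ring
    · exact ⟨0, c, hc, b, hb, d, hd, by simp [hform]⟩

theorem exists_zpow_valuation {q : ℕ} (hq : 2 ≤ q) {t τ : F} (h : τ ^ q + τ = t ^ (q + 1))
    (hgen : IntermediateField.adjoin K {t, τ} = ⊤) (P Q : Place K F)
    (hPt : P.valuation t < 1) (hPτ : P.valuation τ < 1)
    (hQt : Q.valuation t < 1) (hQτ : Q.valuation τ < 1) {f : F} (hf : f ≠ 0) :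
    ∃ m n : ℕ, P.valuation f = P.valuation t ^ m / P.valuation t ^ n ∧
      Q.valuation f = Q.valuation t ^ m / Q.valuation t ^ n := by
  have hs : ∀ R : Place K F, R.valuation τ < 1 → R.valuation (1 + τ ^ (q - 1)) = 1 := by
    intro R hR
    rw [Valuation.map_add_eq_of_lt_left, map_one]
    rw [map_one, map_pow]
    exact pow_lt_one₀ zero_le hR (by omega)
  have key : ∀ a ∈ Algebra.adjoin K {t, τ}, a ≠ 0 → ∃ m : ℕ, ∀ R : Place K F,
      R.valuation t < 1 → R.valuation τ < 1 → R.valuation a = R.valuation t ^ m := by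
    intro a ha ha0
    have hv0 : P.valuation a ≠ 0 := (P.valuation.ne_zero_iff).2 ha0
    have hle : WithZero.exp (-(((-WithZero.log (P.valuation a)).toNat : ℕ) : ℤ)) ≤
        P.valuation a := by
      conv_rhs => rw [← WithZero.exp_log hv0]
      rw [WithZero.exp_le_exp]
      omega
    obtain ⟨m, c, hc, b, hb, d, hd, hm⟩ := exists_local_form hq h P hPt hPτ _ a ha ha0 hle
    refine ⟨m, fun R hRt hRτ => ?_⟩
    have := congrArg R.valuation hm
    rwa [map_mul, map_mul, map_pow, map_pow, hs R hRτ, one_pow, one_mul,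
      R.valuation_const_add hc (R.valuation_le_one_of_mem_adjoin hRt.le hRτ.le hb)
        (R.valuation_le_one_of_mem_adjoin hRt.le hRτ.le hd) hRt hRτ, mul_one] at this
  have hfm : f ∈ IntermediateField.adjoin K {t, τ} := by rw [hgen]; trivial
  obtain ⟨r, hr, s, hs', rfl⟩ := IntermediateField.mem_adjoin_iff_div.1 hfm
  have hr0 : r ≠ 0 := by rintro rfl; simp at hf
  have hs0 : s ≠ 0 := by rintro rfl; simp at hf
  obtain ⟨m, hm⟩ := key r hr hr0
  obtain ⟨n, hn⟩ := key s hs' hs0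
  exact ⟨m, n, by rw [map_div₀, hm P hPt hPτ, hn P hPt hPτ],
    by rw [map_div₀, hm Q hQt hQτ, hn Q hQt hQτ]⟩

theorem Place.valuation_eq_exp_neg_one (P : Place K F) {t : F} (ht : P.valuation t < 1)
    (H : ∀ f : F, f ≠ 0 → ∃ m n : ℕ, P.valuation f = P.valuation t ^ m / P.valuation t ^ n) :
    P.valuation t = WithZero.exp (-1 : ℤ) := by
  obtain ⟨f, hf⟩ := P.surjective (WithZero.exp 1)
  have hf0 : f ≠ 0 := by
    rintro rfl
    rw [map_zero] at hf
    exact WithZero.exp_ne_zero hf.symm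
  obtain ⟨m, n, hmn⟩ := H f hf0
  have ht0 : P.valuation t ≠ 0 := by
    intro h0
    rw [hf, h0] at hmn
    rcases Nat.eq_zero_or_pos m with rfl | hm <;> rcases Nat.eq_zero_or_pos n with rfl | hn
    · rw [pow_zero, div_one, WithZero.exp_eq_one] at hmn
      omega
    · rw [zero_pow hn.ne', div_zero] at hmn
      exact WithZero.exp_ne_zero hmn
    · rw [zero_pow hm.ne', zero_div] at hmn
      exact WithZero.exp_ne_zero hmn
    · rw [zero_pow hm.ne', zero_div] at hmn
      exact WithZero.exp_ne_zero hmn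
  have hlog := congrArg WithZero.log hmn
  rw [hf, WithZero.log_exp, WithZero.log_div (pow_ne_zero _ ht0) (pow_ne_zero _ ht0),
    WithZero.log_pow, WithZero.log_pow] at hlog
  rw [← WithZero.exp_log ht0, ← WithZero.exp_zero, WithZero.exp_lt_exp] at ht
  rw [← WithZero.exp_log ht0, WithZero.exp_inj]
  set l := WithZero.log (P.valuation t)
  have h1 : l * ((m : ℤ) - n) = 1 := by
    simp only [nsmul_eq_mul] at hlog
    linarith
  rcases Int.eq_one_or_neg_one_of_mul_eq_one h1 with h2 | h2 <;> omega

theorem Place.eq_of_local {q : ℕ} (hq : 2 ≤ q) {t τ : F} (h : τ ^ q + τ = t ^ (q + 1))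
    (hgen : IntermediateField.adjoin K {t, τ} = ⊤) (P Q : Place K F)
    (hPt : P.valuation t < 1) (hPτ : P.valuation τ < 1)
    (hQt : Q.valuation t < 1) (hQτ : Q.valuation τ < 1) : P = Q := by
  have hP := P.valuation_eq_exp_neg_one hPt fun f hf => by
    obtain ⟨m, n, h1, _⟩ := exists_zpow_valuation hq h hgen P Q hPt hPτ hQt hQτ hf
    exact ⟨m, n, h1⟩
  have hQ := Q.valuation_eq_exp_neg_one hQt fun f hf => by
    obtain ⟨m, n, _, h1⟩ := exists_zpow_valuation hq h hgen P Q hPt hPτ hQt hQτ hf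
    exact ⟨m, n, h1⟩
  refine Place.ext_valuation fun f => ?_
  by_cases hf : f = 0
  · rw [hf, map_zero, map_zero]
  · obtain ⟨m, n, h1, h2⟩ := exists_zpow_valuation hq h hgen P Q hPt hPτ hQt hQτ hf
    rw [h1, h2, hP, hQ]

end Finiteness

section HermitianFiniteness

theorem finite_of_card (K : Type*) (q : ℕ) [Fact (IsPrimePow q)]
    [hK : Fact (Nat.card K = q ^ 2)] : Finite K := by
  have hq := two_le_of_isPrimePow q
  refine Nat.finite_of_card_ne_zero ?_
  rw [hK.out]
  positivity

variable (K : Type*) [Field K] (q : ℕ) [Fact (IsPrimePow q)]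

theorem sub_pow_of_card [hK : Fact (Nat.card K = q ^ 2)] {F : Type*} [Field F] [Algebra K F]
    (a b : F) : (a - b) ^ q = a ^ q - b ^ q := by
  have hfin := finite_of_card K q
  obtain ⟨p, k, hp, hk, hpk⟩ := (Fact.out : IsPrimePow q)
  obtain ⟨r, hr⟩ := CharP.exists K
  have hrp : r = p := by
    have := Fintype.ofFinite K
    obtain ⟨n, hr', hn⟩ := FiniteField.card K r
    rw [← Nat.card_eq_fintype_card, hK.out, ← hpk, ← pow_mul] at hn
    have h1 : r ∣ p ^ (k * 2) := hn ▸ dvd_pow_self r n.ne_zero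
    exact (Nat.prime_dvd_prime_iff_eq hr' hp.nat_prime).1 (hr'.dvd_of_dvd_pow h1)
  subst hrp
  have : Fact r.Prime := ⟨hp.nat_prime⟩
  have : CharP F r := charP_of_injective_algebraMap (algebraMap K F).injective r
  rw [← hpk]
  exact sub_pow_char_pow a b k

theorem Place.valuation_pow_sub_pow_lt {K F : Type*} [Field K] [Field F] [Algebra K F]
    (P : Place K F) {a b : F} (ha : P.valuation a ≤ 1) (hb : P.valuation b ≤ 1)
    (hab : P.valuation (a - b) < 1) (n : ℕ) : P.valuation (a ^ n - b ^ n) < 1 := by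
  induction n with
  | zero => simp
  | succ n ih =>
    have : a ^ (n + 1) - b ^ (n + 1) = (a - b) * a ^ n + (a ^ n - b ^ n) * b := by ring
    rw [this]
    refine P.valuation.map_add_lt ?_ ?_
    · rw [map_mul, map_pow]
      exact mul_lt_one_of_lt_of_le hab (pow_le_one' ha n)
    · rw [map_mul]
      exact mul_lt_one_of_lt_of_le ih hb

theorem Place.eq_of_finite_point [hK : Fact (Nat.card K = q ^ 2)]
    (P Q : Place K (HermitianField K q)) (α β : K)
    (hPx : P.valuation (hermitianX K q - algebraMap K _ α) < 1)
    (hPy : P.valuation (hermitianY K q - algebraMap K _ β) < 1)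
    (hQx : Q.valuation (hermitianX K q - algebraMap K _ α) < 1)
    (hQy : Q.valuation (hermitianY K q - algebraMap K _ β) < 1) : P = Q := by
  have hq := two_le_of_isPrimePow q
  have hfin := finite_of_card K q
  have heqn := hermitian_equation K q
  have hgen := adjoin_hermitian_eq_top K q
  set x := hermitianX K q with hx
  set y := hermitianY K q with hy
  have hle : ∀ (z : HermitianField K q) (c : K), P.valuation (z - algebraMap K _ c) < 1 →
      P.valuation z ≤ 1 := by
    intro z c hz
    have : z = (z - algebraMap K _ c) + algebraMap K _ c := by ring
    rw [this]
    exact P.valuation.map_add_le hz.le (P.valuation_algebraMap_le_one c)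
  have hαβ : β ^ q + β = α ^ (q + 1) := by
    by_contra hne
    have h1 := P.trivial_on_constants (β ^ q + β - α ^ (q + 1)) (sub_ne_zero.2 hne)
    have hyq := P.valuation_pow_sub_pow_lt (hle y β hPy) (P.valuation_algebraMap_le_one β) hPy q
    have hxq := P.valuation_pow_sub_pow_lt (hle x α hPx) (P.valuation_algebraMap_le_one α) hPx
      (q + 1)
    have : algebraMap K (HermitianField K q) (β ^ q + β - α ^ (q + 1)) =
        (x ^ (q + 1) - algebraMap K _ α ^ (q + 1)) -
          ((y ^ q - algebraMap K _ β ^ q) + (y - algebraMap K _ β)) := by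
      rw [map_sub, map_add, map_pow, map_pow]
      linear_combination heqn
    rw [this] at h1
    have h2 := P.valuation.map_sub_lt hxq (P.valuation.map_add_lt hyq hPy)
    exact h2.ne h1
  have hαq : (α ^ q) ^ q = α := by
    have := @FiniteField.pow_card K _ (Fintype.ofFinite K) α
    rwa [← @Nat.card_eq_fintype_card K (Fintype.ofFinite K), hK.out, sq, pow_mul] at this
  set a := algebraMap K (HermitianField K q) α with ha
  set b := algebraMap K (HermitianField K q) β with hb
  have hab : b ^ q + b = a ^ (q + 1) := by
    rw [ha, hb, ← map_pow, ← map_pow, ← map_add, hαβ]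
  have haq : (a ^ q) ^ q = a := by
    rw [ha, ← map_pow, ← map_pow, hαq]
  have hval : ∀ R : Place K (HermitianField K q), R.valuation (x - a) < 1 →
      R.valuation (y - b) < 1 → R.valuation (y - b - a ^ q * (x - a)) < 1 := by
    intro R hRx hRy
    refine R.valuation.map_sub_lt hRy ?_
    rw [mul_comm, map_mul, map_pow]
    exact mul_lt_one_of_lt_of_le hRx (pow_le_one' (R.valuation_algebraMap_le_one α) q)
  refine Place.eq_of_local (t := x - a) (τ := y - b - a ^ q * (x - a)) hq ?_ ?_ P Q
    hPx (hval P hPx hPy) hQx (hval Q hQx hQy)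
  · rw [pow_succ (x - a), sub_pow_of_card K q (y - b), mul_pow, haq, sub_pow_of_card K q y,
      sub_pow_of_card K q x]
    linear_combination heqn - hab
  · rw [eq_top_iff, ← hgen, IntermediateField.adjoin_le_iff]
    set S := IntermediateField.adjoin K {x - a, y - b - a ^ q * (x - a)}
    have h1 : x - a ∈ S := IntermediateField.subset_adjoin _ _ (by simp)
    have h2 : y - b - a ^ q * (x - a) ∈ S := IntermediateField.subset_adjoin _ _ (by simp)
    have h3 : a ∈ S := S.algebraMap_mem α
    have h4 : b ∈ S := S.algebraMap_mem β
    rintro z (rfl | rfl)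
    · have := S.add_mem h1 h3
      rwa [sub_add_cancel] at this
    · have := S.add_mem (S.add_mem h2 (S.mul_mem (pow_mem h3 q) h1)) h4
      rwa [sub_add_cancel, sub_add_cancel] at this

theorem Place.eq_of_pole (P Q : Place K (HermitianField K q))
    (hP : 1 < P.valuation (hermitianX K q)) (hQ : 1 < Q.valuation (hermitianX K q)) : P = Q := by
  have hq := two_le_of_isPrimePow q
  have heqn := hermitian_equation K q
  have hgen := adjoin_hermitian_eq_top K q
  set x := hermitianX K q with hx
  set y := hermitianY K q with hy
  have hval : ∀ R : Place K (HermitianField K q), 1 < R.valuation x →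
      1 < R.valuation y ∧ R.valuation x < R.valuation y := by
    intro R hR
    have hv := congrArg R.valuation heqn
    rw [map_pow] at hv
    have h1 : 1 < R.valuation y := by
      by_contra hle
      rw [not_lt] at hle
      have h2 : R.valuation (y ^ q + y) ≤ 1 := by
        refine R.valuation.map_add_le ?_ hle
        rw [map_pow]
        exact pow_le_one' hle q
      rw [hv] at h2
      exact absurd (one_lt_pow₀ hR (by omega)) (not_lt.2 h2)
    refine ⟨h1, ?_⟩
    have h3 : R.valuation y < R.valuation (y ^ q) := by
      rw [map_pow]
      exact lt_self_pow₀ h1 (by omega)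
    rw [Valuation.map_add_eq_of_lt_left _ h3, map_pow] at hv
    have h4 : R.valuation x ^ q < R.valuation y ^ q := by
      rw [hv]
      exact pow_lt_pow_right₀ hR (by omega)
    exact lt_of_pow_lt_pow_left₀ q zero_le h4
  have hy0 : y ≠ 0 := by
    intro h0
    have := (hval P hP).1
    rw [h0, map_zero] at this
    exact absurd this (not_lt.2 zero_le)
  have hτ : ∀ R : Place K (HermitianField K q), 1 < R.valuation x → R.valuation y⁻¹ < 1 := by
    intro R hR
    rw [map_inv₀]
    exact inv_lt_one_of_one_lt₀ (hval R hR).1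
  have ht : ∀ R : Place K (HermitianField K q), 1 < R.valuation x → R.valuation (x / y) < 1 := by
    intro R hR
    rw [map_div₀]
    exact (div_lt_one₀ (zero_lt_one.trans (hval R hR).1)).2 (hval R hR).2
  refine Place.eq_of_local (t := x / y) (τ := y⁻¹) hq ?_ ?_ P Q
    (ht P hP) (hτ P hP) (ht Q hQ) (hτ Q hQ)
  · rw [div_pow, ← heqn, inv_pow]
    field_simp
    ring
  · rw [eq_top_iff, ← hgen, IntermediateField.adjoin_le_iff]
    set S := IntermediateField.adjoin K {x / y, y⁻¹}
    have h1 : x / y ∈ S := IntermediateField.subset_adjoin _ _ (by simp)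
    have h2 : y⁻¹ ∈ S := IntermediateField.subset_adjoin _ _ (by simp)
    have h3 : y ∈ S := by simpa using S.inv_mem h2
    rintro z (rfl | rfl)
    · have := S.mul_mem h1 h3
      rwa [div_mul_cancel₀ _ hy0] at this
    · exact h3

instance [hK : Fact (Nat.card K = q ^ 2)] : Finite (RationalPlace K (HermitianField K q)) := by
  classical
  have hfin := finite_of_card K q
  have hq := two_le_of_isPrimePow q
  let C : RationalPlace K (HermitianField K q) → K × K → Prop := fun P c =>
    P.1.valuation (hermitianX K q - algebraMap K _ c.1) < 1 ∧
      P.1.valuation (hermitianY K q - algebraMap K _ c.2) < 1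
  let g : RationalPlace K (HermitianField K q) → Option (K × K) := fun P =>
    if h : ∃ c, C P c then some h.choose else none
  have hnone : ∀ P : RationalPlace K (HermitianField K q), (¬ ∃ c, C P c) →
      1 < P.1.valuation (hermitianX K q) := by
    intro P hP
    by_contra hle
    rw [not_lt] at hle
    refine hP ?_
    have hy : P.1.valuation (hermitianY K q) ≤ 1 := by
      by_contra hlt
      rw [not_le] at hlt
      have hv := congrArg P.1.valuation (hermitian_equation K q)
      have h3 : P.1.valuation (hermitianY K q) < P.1.valuation (hermitianY K q ^ q) := by
        rw [map_pow]
        exact lt_self_pow₀ hlt (by omega)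
      rw [Valuation.map_add_eq_of_lt_left _ h3, map_pow, map_pow] at hv
      have h4 : P.1.valuation (hermitianX K q) ^ (q + 1) ≤ 1 := pow_le_one' hle _
      rw [← hv] at h4
      exact absurd (one_lt_pow₀ hlt (by omega)) (not_lt.2 h4)
    obtain ⟨α, hα⟩ := P.2.exists_const hle
    obtain ⟨β, hβ⟩ := P.2.exists_const hy
    exact ⟨(α, β), hα, hβ⟩
  refine Finite.of_injective g fun P Q hPQ => Subtype.ext ?_
  by_cases hP : ∃ c, C P c <;> by_cases hQ : ∃ c, C Q c
  · have h : hP.choose = hQ.choose := by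
      have : g P = some hP.choose := dif_pos hP
      have hQ' : g Q = some hQ.choose := dif_pos hQ
      rw [this, hQ'] at hPQ
      exact Option.some.inj hPQ
    have h1 := hP.choose_spec
    have h2 := hQ.choose_spec
    rw [← h] at h2
    exact Place.eq_of_finite_point K q P.1 Q.1 _ _ h1.1 h1.2 h2.1 h2.2
  · have : g P = some hP.choose := dif_pos hP
    rw [this, show g Q = none from dif_neg hQ] at hPQ
    cases hPQ
  · have : g Q = some hQ.choose := dif_pos hQ
    rw [this, show g P = none from dif_neg hP] at hPQ
    cases hPQ
  · exact Place.eq_of_pole K q P.1 Q.1 (hnone P hP) (hnone Q hQ)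

noncomputable instance [Fact (Nat.card K = q ^ 2)] :
    Fintype (RationalPlace K (HermitianField K q)) :=
  Fintype.ofFinite _

/-- The Hermitian function field lattice `L_𝒫 ⊆ ℝ^𝒫`, for the field `K` with `q ^ 2` elements. -/
noncomputable abbrev hermitianLattice [Fact (Nat.card K = q ^ 2)] :
    AddSubgroup (EuclideanSpace ℝ (RationalPlace K (HermitianField K q))) :=
  lattice K (HermitianField K q)

end HermitianFiniteness

end FunctionFieldLattice

/-!
A minimal vector of the Hermitian lattice has norm `√(2 q)`, and many such vectors come from
quotients of two linear functions.

*Lower bound for the norm.* If all poles of `g` are rational, the orders of `g` at the rational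
places have a nonpositive sum (`sum_order_nonpos`). To see this, multiply `g` by a power of
`x ^ (q ^ 2) - x` to make it regular on the affine curve. It is then integral over `K[x]`, so its
norm to `K(x)` is a polynomial `h(x)`. Since `H / K(x)` is Galois and its group permutes the `q`
points over each `a ∈ K` simply transitively (`exists_galois_bijective`), the orders over `a` add up
to the multiplicity of the root `a` of `h`, while the order at infinity is `-deg h`. Applied to
`f - c` for a nonconstant `f` in `𝒪_𝒫^*`, this shows that `f` takes each of the `q ^ 2 + 1` values
in `K ∪ {∞}` at no more rational places than its degree. As there are `q ^ 3 + 1` rational places,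
the degree is at least `q` (`le_sum_poles`), and the squared norm of the divisor is at least `2 q`.

*Rational places.* Each rational point of the curve has local functions `(t, τ)` that generate `H`
and satisfy the same equation `τ ^ q + τ = t ^ (q + 1)`. Hence they are the image of `(x, y)` under
an automorphism of `H`, and one common zero of `x` and `y` produces places at all points; these are
exactly the rational places (`pointEquiv`).

*Construction.* A line over `K` that is not tangent to the projective curve meets it in `q + 1`
distinct rational points, so the divisor of its linear function is the sum of these points minus
`(q + 1) ∞` (`SecantLine.order_function`). For two such lines through a common rational point of the
curve, the quotient of the linear functions has `q` simple zeros and `q` simple poles, all rational,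
so its divisor is a minimal vector. As `q ≥ 2`, the zeros and the poles determine the two lines.
There are `q ^ 2` such lines through each of the `q ^ 3 + 1` points, which gives
`(q ^ 3 + 1) (q ^ 4 - q ^ 2) = q ^ 7 - q ^ 5 + q ^ 4 - q ^ 2` minimal vectors.
-/

namespace FunctionFieldLattice

/-! ### Regular functions and integrality -/

section AffinePlaces

open IntermediateField.algebraAdjoinAdjoin
open scoped IntermediateField

variable {K F : Type*} [Field K] [Field F] [Algebra K F] {x : F}

theorem isPrincipalIdealRing_adjoin_singleton (hx : Transcendental K x) :
    IsPrincipalIdealRing (Algebra.adjoin K {x}) :=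
  IsPrincipalIdealRing.of_surjective
    (Polynomial.algEquivOfTranscendental K x hx : Polynomial K →+* Algebra.adjoin K {x})
    (Polynomial.algEquivOfTranscendental K x hx).surjective

/-- A function that is regular at all places where `x` is regular is integral over `K[x]`: the
integral closure of `K[x]` is a Dedekind domain, and each of its maximal ideals defines a place. -/
theorem isIntegral_of_valuation_le_one (hx : Transcendental K x) [FiniteDimensional K⟮x⟯ F]
    [Algebra.IsSeparable K⟮x⟯ F] {g : F}
    (h : ∀ P : Place K F, P.valuation x ≤ 1 → P.valuation g ≤ 1) :
    IsIntegral (Algebra.adjoin K {x}) g := by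
  have := isPrincipalIdealRing_adjoin_singleton hx
  let C := integralClosure (Algebra.adjoin K {x}) F
  have : IsDedekindDomain C := integralClosure.isDedekindDomain _ K⟮x⟯ _
  have : IsFractionRing C F :=
    IsIntegralClosure.isFractionRing_of_finite_extension (Algebra.adjoin K {x}) K⟮x⟯ F C
  have hg : g ∈ (algebraMap C F).range := by
    refine IsDedekindDomain.HeightOneSpectrum.mem_integers_of_valuation_le_one F g fun v => ?_
    let P : Place K F :=
      { valuation := v.valuation F
        surjective := v.valuation_surjective F
        trivial_on_constants := fun c hc => by
          have hle : ∀ a : K, v.valuation F (algebraMap K F a) ≤ 1 := fun a =>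
            v.valuation_le_one (K := F) (algebraMap (Algebra.adjoin K {x}) C (algebraMap K _ a))
          refine le_antisymm (hle c) ?_
          have h1 := hle c⁻¹
          rw [map_inv₀, map_inv₀] at h1
          refine (inv_le_one₀ ?_).1 h1
          exact zero_lt_iff.2 ((Valuation.ne_zero_iff _).2
            ((map_ne_zero (algebraMap K F)).2 hc)) }
    exact h P (v.valuation_le_one (K := F) (algebraMap (Algebra.adjoin K {x}) C
      ⟨x, Algebra.self_mem_adjoin_singleton K x⟩))
  obtain ⟨c, rfl⟩ := hg
  exact c.2

theorem exists_aeval_eq_of_isIntegral (hx : Transcendental K x) {g : F} (hg : g ∈ K⟮x⟯)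
    (hint : IsIntegral (Algebra.adjoin K {x}) g) :
    ∃ p : Polynomial K, Polynomial.aeval x p = g := by
  have := isPrincipalIdealRing_adjoin_singleton hx
  have h1 : IsIntegral (Algebra.adjoin K {x}) (⟨g, hg⟩ : K⟮x⟯) :=
    (isIntegral_algebraMap_iff (A := K⟮x⟯) (algebraMap K⟮x⟯ F).injective).1 hint
  obtain ⟨⟨a, ha⟩, h2⟩ := IsIntegrallyClosed.isIntegral_iff.1 h1
  rw [Algebra.adjoin_singleton_eq_range_aeval] at ha
  obtain ⟨p, hp⟩ := ha
  exact ⟨p, hp.trans (congrArg Subtype.val h2)⟩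

/-- The element `x` has a zero, since otherwise `1 / x` would be integral over `K[x]`. -/
theorem exists_place_valuation_lt_one (hx : Transcendental K x) [FiniteDimensional K⟮x⟯ F]
    [Algebra.IsSeparable K⟮x⟯ F] : ∃ P : Place K F, P.valuation x < 1 := by
  by_contra! hne
  have hint : IsIntegral (Algebra.adjoin K {x}) x⁻¹ :=
    isIntegral_of_valuation_le_one hx fun P _ => by
      rw [map_inv₀]
      exact inv_le_one_of_one_le₀ (hne P)
  obtain ⟨p, hp⟩ := exists_aeval_eq_of_isIntegral hx
    (inv_mem (IntermediateField.mem_adjoin_simple_self K x)) hint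
  have hx0 : x ≠ 0 := fun h0 => hx (h0 ▸ isAlgebraic_zero)
  -- If `1 / x = p(x)`, then `x` is a root of `X * p - 1`.
  refine hx ⟨Polynomial.X * p - 1, fun h0 => ?_, by simp [hp, hx0]⟩
  have := congrArg (Polynomial.eval 0) h0
  simp at this

end AffinePlaces

/-! ### Fibres of the trace and the norm of a finite field -/

section Counting

/-- If the kernel and the image of a homomorphism are bounded by factors of the order of a finite
group whose product is that order, then both bounds are attained. -/
theorem card_ker_eq_and_card_range_eq {G G' : Type*} [Group G] [Group G'] [Finite G]
    (φ : G →* G') {a b : ℕ} (hG : Nat.card G = a * b) (hk : Nat.card φ.ker ≤ a)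
    (hr : Nat.card φ.range ≤ b) : Nat.card φ.ker = a ∧ Nat.card φ.range = b := by
  have h1 := φ.ker.card_mul_index
  rw [Subgroup.index_ker, hG] at h1
  have hpos : 0 < a * b := hG ▸ Nat.card_pos
  have ha : 0 < a := Nat.pos_of_mul_pos_right hpos
  have hb : 0 < b := Nat.pos_of_mul_pos_left hpos
  constructor
  · by_contra hne
    have : Nat.card φ.ker * Nat.card φ.range < a * b :=
      Nat.mul_lt_mul_of_lt_of_le (lt_of_le_of_ne hk hne) hr hb
    omega
  · by_contra hne
    have : Nat.card φ.ker * Nat.card φ.range < a * b :=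
      Nat.mul_lt_mul_of_le_of_lt hk (lt_of_le_of_ne hr hne) ha
    omega

theorem ncard_fiber_eq_card_ker {G G' : Type*} [Group G] [Group G'] (φ : G →* G') (g : G) :
    {z | φ z = φ g}.ncard = Nat.card φ.ker := by
  rw [← Nat.card_coe_set_eq]
  refine Nat.card_congr
    ⟨fun z => ⟨g⁻¹ * z.1, ?_⟩, fun k => ⟨g * k.1, ?_⟩, fun z => ?_, fun k => ?_⟩
  · have : φ z.1 = φ g := z.2
    simp [MonoidHom.mem_ker, this]
  · have : φ k.1 = 1 := k.2
    simp [this]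
  · simp
  · simp

open Polynomial

theorem ncard_zeros_le {K : Type*} [Field K] (p : K[X]) (hp : p ≠ 0) :
    {z : K | p.eval z = 0}.ncard ≤ p.natDegree := by
  classical
  have : {z : K | p.eval z = 0} = (p.roots.toFinset : Set K) := by
    ext z
    simp [hp]
  rw [this, Set.ncard_coe_finset]
  exact (Multiset.toFinset_card_le _).trans (card_roots' p)

theorem aeval_eq_prod_of_natDegree_le_card {K : Type*} [Field K] {p : K[X]} (hp : p.Monic)
    {s : Finset K} (hs : ∀ z ∈ s, p.eval z = 0) (hcard : p.natDegree ≤ s.card)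
    {F : Type*} [Field F] [Algebra K F] (z : F) :
    aeval z p = ∏ b ∈ s, (z - algebraMap K F b) := by
  have h1 : s.val = p.roots := by
    refine Multiset.eq_of_le_of_card_le
      ((Multiset.le_iff_subset s.nodup).2 fun b hb => ?_) ((card_roots' p).trans hcard)
    exact (mem_roots hp.ne_zero).2 (hs b hb)
  have h2 : p.Splits := by
    rw [splits_iff_card_roots, ← h1]
    exact le_antisymm (h1 ▸ card_roots' p) hcard
  rw [(h2.map (algebraMap K F)).aeval_eq_prod_aroots_of_monic hp, aroots, h2.roots_map, ← h1,
    Multiset.map_map]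
  rfl

theorem ncard_pow_eq_self_le (K : Type*) [Field K] {q : ℕ} (hq : 2 ≤ q) :
    {z : K | z ^ q = z}.ncard ≤ q := by
  have hdeg : (X ^ q - X : K[X]).natDegree = q := by
    rw [natDegree_sub_eq_left_of_natDegree_lt] <;> simp; omega
  have := ncard_zeros_le (X ^ q - X : K[X]) (fun h => by rw [h] at hdeg; simp at hdeg; omega)
  rw [hdeg] at this
  simpa [sub_eq_zero] using this

variable {K : Type*} [Field K] (q : ℕ) [Fact (IsPrimePow q)] [hK : Fact (Nat.card K = q ^ 2)]

theorem add_pow_of_card {F : Type*} [Field F] [Algebra K F] (a b : F) :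
    (a + b) ^ q = a ^ q + b ^ q := by
  have h := sub_pow_of_card K q (a + b) b
  rw [add_sub_cancel_right] at h
  rw [h]
  ring

theorem pow_pow_of_card (a : K) : (a ^ q) ^ q = a := by
  have hfin := finite_of_card K q
  have := @FiniteField.pow_card K _ (Fintype.ofFinite K) a
  rwa [← @Nat.card_eq_fintype_card K (Fintype.ofFinite K), hK.out, sq, pow_mul] at this

/-- The map `b ↦ b ^ q + b`, the trace of `K` over its subfield with `q` elements. -/
noncomputable def traceHom : K →+ K :=
  AddMonoidHom.mk' (fun b => b ^ q + b) fun a b => by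
    rw [add_pow_of_card (K := K) q]
    ring

theorem traceHom_apply (b : K) : traceHom q b = b ^ q + b := rfl

theorem trace_pow (b : K) : (b ^ q + b) ^ q = b ^ q + b := by
  rw [add_pow_of_card (K := K) q, pow_pow_of_card q b, add_comm]

theorem card_ker_traceHom_and_range :
    Nat.card (traceHom (K := K) q).ker = q ∧ Nat.card (traceHom (K := K) q).range = q := by
  have hq := two_le_of_isPrimePow q
  have hfin := finite_of_card K q
  have hdeg : (X ^ q + X : K[X]).natDegree = q := by
    rw [natDegree_add_eq_left_of_natDegree_lt] <;> simp; omega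
  have hk : Nat.card (traceHom (K := K) q).ker ≤ q := by
    have := ncard_zeros_le (X ^ q + X : K[X]) (fun h => by rw [h] at hdeg; simp at hdeg; omega)
    rw [hdeg] at this
    refine le_trans (le_of_eq ?_) this
    rw [← Nat.card_coe_set_eq]
    refine Nat.card_congr (Equiv.subtypeEquivRight fun z => ?_)
    simp [AddMonoidHom.mem_ker, traceHom_apply]
  have hr : Nat.card (traceHom (K := K) q).range ≤ q := by
    refine le_trans ?_ (ncard_pow_eq_self_le K (two_le_of_isPrimePow q))
    rw [← SetLike.coe_sort_coe, Nat.card_coe_set_eq]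
    refine Set.ncard_le_ncard ?_ (Set.toFinite _)
    rintro _ ⟨b, rfl⟩
    exact trace_pow q b
  exact card_ker_eq_and_card_range_eq (traceHom (K := K) q).toMultiplicative (a := q) (b := q)
    (by rw [← sq, ← hK.out]; rfl) hk hr

/-- The trace map takes each value in the subfield with `q` elements exactly `q` times. -/
theorem ncard_trace_fiber {c : K} (hc : c ^ q = c) : {b : K | b ^ q + b = c}.ncard = q := by
  have hfin := finite_of_card K q
  obtain ⟨h1, h2⟩ := card_ker_traceHom_and_range (K := K) q
  have hsub : ((traceHom (K := K) q).range : Set K) ⊆ {z : K | z ^ q = z} := by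
    rintro _ ⟨b, rfl⟩
    exact trace_pow q b
  have heq := Set.eq_of_subset_of_ncard_le hsub (by
    rw [← Nat.card_coe_set_eq (s := ((traceHom (K := K) q).range : Set K))]
    exact (ncard_pow_eq_self_le K (two_le_of_isPrimePow q)).trans h2.ge) (Set.toFinite _)
  have hmem : c ∈ ((traceHom (K := K) q).range : Set K) := by
    rw [heq]
    exact hc
  obtain ⟨b, rfl⟩ := hmem
  exact (ncard_fiber_eq_card_ker (traceHom (K := K) q).toMultiplicative (.ofAdd b)).trans h1

/-- The norm map takes each nonzero value in the subfield with `q` elements exactly `q + 1`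
times. -/
theorem ncard_norm_fiber {e : K} (he : e ^ q = e) (he0 : e ≠ 0) :
    {z : K | z ^ (q + 1) = e}.ncard = q + 1 := by
  have hq := two_le_of_isPrimePow q
  have hfin := finite_of_card K q
  let φ : Kˣ →* Kˣ := powMonoidHom (q + 1)
  have hφ : ∀ u, φ u = u ^ (q + 1) := fun u => rfl
  have hval : ∀ S : Set Kˣ, S.ncard = (Units.val '' S).ncard := fun S =>
    (Set.ncard_image_of_injective S Units.val_injective).symm
  have hq2 : ∀ u : Kˣ, (u ^ (q + 1)) ^ (q - 1) = 1 := by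
    intro u
    have h1 := pow_pow_of_card q (u : K)
    ext
    push_cast
    have h2 : (u : K) * ((u : K) ^ (q + 1)) ^ (q - 1) = u * 1 := by
      rw [← pow_mul, ← pow_succ', mul_one]
      rw [← pow_mul] at h1
      nth_rewrite 2 [← h1]
      congr 1
      obtain ⟨k, rfl⟩ : ∃ k, q = k + 1 := ⟨q - 1, by omega⟩
      simp only [Nat.add_sub_cancel]
      ring
    exact mul_left_cancel₀ u.ne_zero h2
  have hzeros : ∀ n : ℕ, 0 < n → {u : Kˣ | u ^ n = 1}.ncard ≤ n := by
    intro n hn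
    have hdeg : (X ^ n - 1 : K[X]).natDegree = n := by
      rw [← C_1, natDegree_X_pow_sub_C]
    have := ncard_zeros_le (X ^ n - 1 : K[X]) (fun h => by rw [h] at hdeg; simp at hdeg; omega)
    rw [hdeg] at this
    rw [hval]
    refine (Set.ncard_le_ncard ?_ (Set.toFinite _)).trans this
    rintro _ ⟨u, hu, rfl⟩
    have hu' : u ^ n = 1 := hu
    have := congrArg Units.val hu'
    push_cast at this
    simp [this]
  have hsub : (φ.range : Set Kˣ) ⊆ {u : Kˣ | u ^ (q - 1) = 1} := by
    rintro _ ⟨u, rfl⟩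
    exact hq2 u
  have hcard : Nat.card Kˣ = (q + 1) * (q - 1) := by
    rw [Nat.card_units, hK.out]
    obtain ⟨k, rfl⟩ : ∃ k, q = k + 1 := ⟨q - 1, by omega⟩
    rw [Nat.add_sub_cancel]
    refine Nat.sub_eq_of_eq_add ?_
    ring
  obtain ⟨h1, h2⟩ := card_ker_eq_and_card_range_eq φ hcard (hzeros (q + 1) (by omega))
    ((Set.ncard_le_ncard hsub (Set.toFinite _)).trans (hzeros (q - 1) (by omega)))
  have heq := Set.eq_of_subset_of_ncard_le hsub
    ((hzeros (q - 1) (by omega)).trans h2.ge) (Set.toFinite _)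
  have hmem : Units.mk0 e he0 ∈ (φ.range : Set Kˣ) := by
    rw [heq, Set.mem_ofPred_eq]
    ext
    push_cast
    refine mul_left_cancel₀ he0 ?_
    rw [Units.val_mk0, mul_one, ← pow_succ', Nat.sub_add_cancel (by omega), he]
  obtain ⟨u, hu⟩ := hmem
  refine Eq.trans ?_ h1
  rw [← ncard_fiber_eq_card_ker φ u, hval]
  congr 1
  ext z
  simp only [Set.mem_ofPred_eq, Set.mem_image, hφ]
  constructor
  · intro hz
    have hz0 : z ≠ 0 := by
      rintro rfl
      rw [zero_pow (by omega)] at hz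
      exact he0 hz.symm
    refine ⟨Units.mk0 z hz0, ?_, rfl⟩
    rw [← hφ u, hu]
    ext
    simpa using hz
  · rintro ⟨w, hw, rfl⟩
    rw [← hφ u, hu] at hw
    simpa using congrArg Units.val hw

end Counting

/-! ### Generators satisfying the Hermitian equation -/

section Generators

open Polynomial
open scoped IntermediateField

/-- Two elements `t`, `τ` of an extension `F / K` that generate it and satisfy the Hermitian
equation `τ ^ q + τ = t ^ (q + 1)`. -/
structure IsHermitianPair (K : Type*) {F : Type*} [Field K] [Field F] [Algebra K F] (q : ℕ)
    (t τ : F) : Prop where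
  equation : τ ^ q + τ = t ^ (q + 1)
  adjoin_eq_top : IntermediateField.adjoin K {t, τ} = ⊤

theorem natCast_eq_zero_of_card (K : Type*) [Field K] (q : ℕ) [hK : Fact (Nat.card K = q ^ 2)] :
    (q : K) = 0 := by
  rcases eq_or_ne q 0 with rfl | hq
  · simp
  have : Finite K := Nat.finite_of_card_ne_zero (hK.out ▸ pow_ne_zero 2 hq)
  have := Fintype.ofFinite K
  have h := Nat.cast_card_eq_zero K
  rw [← Nat.card_eq_fintype_card, hK.out, Nat.cast_pow] at h
  exact pow_eq_zero_iff two_ne_zero |>.1 h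

theorem splits_of_natDegree_le_ncard {F : Type*} [Field F] {p : F[X]} {S : Set F}
    (hS : ∀ z ∈ S, p.eval z = 0) (hp : p ≠ 0) (h : p.natDegree ≤ S.ncard) : p.Splits := by
  classical
  rw [splits_iff_card_roots]
  refine le_antisymm (card_roots' p) (h.trans ?_)
  have hsub : S ⊆ p.roots.toFinset := fun z hz => by simpa [hp] using hS z hz
  refine (Set.ncard_le_ncard hsub (Finset.finite_toSet _)).trans ?_
  rw [Set.ncard_coe_finset]
  exact Multiset.toFinset_card_le _

variable {K F : Type*} [Field K] [Field F] [Algebra K F] {q : ℕ} {t τ : F}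

namespace IsHermitianPair

theorem isAlgebraic_of_left (h : IsHermitianPair K q t τ) (hq : 2 ≤ q) (ht : IsAlgebraic K t) :
    Algebra.IsAlgebraic K F := by
  have hτ : IsAlgebraic K τ := by
    have hdeg : (X ^ q + X : K[X]).natDegree = q := by
      rw [natDegree_add_eq_left_of_natDegree_lt] <;> simp; omega
    refine IsAlgebraic.of_aeval (X ^ q + X : K[X]) (by omega) ?_ ?_
    · refine mem_nonZeroDivisors_of_ne_zero (leadingCoeff_ne_zero.2 fun h0 => ?_)
      rw [h0] at hdeg
      simp at hdeg
      omega
    · simpa [h.equation] using ht.pow (q + 1)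
  have : Algebra.IsAlgebraic K (IntermediateField.adjoin K {t, τ}) := by
    refine IntermediateField.isAlgebraic_adjoin fun z hz => ?_
    rcases hz with rfl | rfl
    · exact ht.isIntegral
    · exact hτ.isIntegral
  rw [h.adjoin_eq_top] at this
  exact ⟨fun z => (isAlgebraic_algebraMap_iff
    (algebraMap (⊤ : IntermediateField K F) F).injective).2
    (this.isAlgebraic (⟨z, trivial⟩ : (⊤ : IntermediateField K F)))⟩

theorem isAlgebraic_of_right (h : IsHermitianPair K q t τ) (hq : 2 ≤ q) (hτ : IsAlgebraic K τ) :
    Algebra.IsAlgebraic K F := by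
  refine h.isAlgebraic_of_left hq ?_
  refine IsAlgebraic.of_pow (n := q + 1) (by omega) ?_
  rw [← h.equation]
  exact (hτ.pow q).add hτ

theorem adjoin_simple_adjoin (h : IsHermitianPair K q t τ) : K⟮t⟯⟮τ⟯ = ⊤ := by
  have h1 := IntermediateField.adjoin_simple_adjoin_simple K t τ
  rw [h.adjoin_eq_top] at h1
  refine IntermediateField.restrictScalars_injective K ?_
  rw [h1]
  rfl

/-- The extension `F / K(t)` is the splitting field of `X ^ q + X - t ^ (q + 1)`, whose derivative
is `1` and whose roots are the elements `τ + β` with `β ^ q + β = 0`. -/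
theorem isGalois [Fact (IsPrimePow q)] [Fact (Nat.card K = q ^ 2)]
    (h : IsHermitianPair K q t τ) : FiniteDimensional K⟮t⟯ F ∧ IsGalois K⟮t⟯ F := by
  have hq := two_le_of_isPrimePow q
  let p : K⟮t⟯[X] := X ^ q + X - C (IntermediateField.AdjoinSimple.gen K t ^ (q + 1))
  have hdeg : p.natDegree = q := by
    unfold p
    rw [natDegree_sub_C, natDegree_add_eq_left_of_natDegree_lt] <;> simp; omega
  have hp0 : p ≠ 0 := by
    intro h0
    rw [h0] at hdeg
    simp at hdeg
    omega
  have hroot : ∀ z : F, aeval z p = z ^ q + z - t ^ (q + 1) := by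
    intro z
    simp [p]
  have hder : derivative p = 1 := by
    have hq0 : (q : K⟮t⟯) = 0 := by
      have := congrArg (algebraMap K K⟮t⟯) (natCast_eq_zero_of_card K q)
      simpa using this
    simp only [p, derivative_sub, derivative_add, derivative_X_pow, derivative_C, derivative_X]
    simp [hq0]
  have hsep : p.Separable := by
    rw [Polynomial.Separable, hder]
    exact isCoprime_one_right
  have hB : {β : K | β ^ q + β = 0}.ncard = q := ncard_trace_fiber q (by simp; omega)
  have hsplit : (p.map (algebraMap K⟮t⟯ F)).Splits := by
    refine splits_of_natDegree_le_ncard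
      (S := (fun β => τ + algebraMap K F β) '' {β : K | β ^ q + β = 0}) ?_ ?_ ?_
    · rintro _ ⟨β, hβ, rfl⟩
      have hβ' : β ^ q + β = 0 := hβ
      have := congrArg (algebraMap K F) hβ'
      rw [map_add, map_pow, map_zero] at this
      rw [eval_map_algebraMap, hroot, add_pow_of_card (K := K) q, ← h.equation]
      linear_combination this
    · exact (Polynomial.map_ne_zero_iff (algebraMap K⟮t⟯ F).injective).2 hp0
    · rw [natDegree_map, hdeg, Set.ncard_image_of_injective, hB]
      intro a b hab
      exact (algebraMap K F).injective (add_left_cancel hab)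
  have hsf : p.IsSplittingField K⟮t⟯ F := by
    refine ⟨hsplit, ?_⟩
    have hint : IsIntegral K⟮t⟯ τ :=
      IsAlgebraic.isIntegral ⟨p, hp0, by rw [hroot, h.equation, sub_self]⟩
    have h1 : Algebra.adjoin K⟮t⟯ {τ} = ⊤ := by
      rw [← IntermediateField.adjoin_simple_toSubalgebra_of_isAlgebraic hint.isAlgebraic,
        h.adjoin_simple_adjoin]
      rfl
    rw [eq_top_iff, ← h1]
    refine Algebra.adjoin_mono (Set.singleton_subset_iff.2 ?_)
    rw [mem_rootSet]
    exact ⟨hp0, by rw [hroot, h.equation, sub_self]⟩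
  exact ⟨Polynomial.IsSplittingField.finiteDimensional F p,
    IsGalois.of_separable_splitting_field hsep⟩

end IsHermitianPair

end Generators

/-! ### Rationality of places and local parameters -/

section LocalExpansion

variable {K F : Type*} [Field K] [Field F] [Algebra K F]

namespace Place

theorem isRational_of_exists_const (P : Place K F)
    (h : ∀ f, P.valuation f = 1 → ∃ c : K, P.valuation (f - algebraMap K F c) < 1) :
    P.IsRational := by
  let : Algebra K (IsLocalRing.ResidueField P.valuation.valuationSubring) :=
    ((IsLocalRing.residue P.valuation.valuationSubring).comp P.constants).toAlgebra
  change Module.finrank K (IsLocalRing.ResidueField P.valuation.valuationSubring) = 1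
  refine (finrank_eq_one_iff_of_nonzero' (K := K) (1 : IsLocalRing.ResidueField
    P.valuation.valuationSubring) one_ne_zero).2 fun w => ?_
  obtain ⟨g, rfl⟩ := IsLocalRing.residue_surjective w
  have hlt : ∀ a : P.valuation.valuationSubring, P.valuation (a : F) < 1 →
      IsLocalRing.residue P.valuation.valuationSubring a = 0 := by
    intro a ha
    rw [IsLocalRing.residue_eq_zero_iff, IsLocalRing.mem_maximalIdeal]
    intro hu
    obtain ⟨b, hb⟩ := hu.exists_right_inv
    have h1 := congrArg (fun z : P.valuation.valuationSubring => P.valuation (z : F)) hb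
    simp only [MulMemClass.coe_mul, map_mul, OneMemClass.coe_one, map_one] at h1
    have hb' : P.valuation (b : F) ≤ 1 := (P.valuation.mem_valuationSubring_iff _).1 b.2
    exact (mul_lt_one_of_lt_of_le ha hb').ne h1
  have hg : P.valuation (g : F) ≤ 1 := (P.valuation.mem_valuationSubring_iff _).1 g.2
  have hex : ∃ c : K, P.valuation ((g : F) - algebraMap K F c) < 1 := by
    rcases hg.lt_or_eq with h1 | h1
    · exact ⟨0, by simpa using h1⟩
    · exact h _ h1
  obtain ⟨c, hc⟩ := hex
  refine ⟨c, ?_⟩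
  rw [Algebra.smul_def, mul_one]
  change IsLocalRing.residue _ (P.constants c) = _
  rw [eq_comm, ← sub_eq_zero, ← map_sub]
  exact hlt _ hc

/-- The place `f ↦ P (σ f)`. -/
def comap {F' : Type*} [Field F'] [Algebra K F'] (P : Place K F) (σ : F' ≃ₐ[K] F) :
    Place K F' where
  valuation := P.valuation.comap (σ : F' →+* F)
  surjective v := by
    obtain ⟨f, hf⟩ := P.surjective v
    exact ⟨σ.symm f, by simpa using hf⟩
  trivial_on_constants c hc := by
    simpa using P.trivial_on_constants c hc

@[simp]
theorem comap_valuation {F' : Type*} [Field F'] [Algebra K F'] (P : Place K F)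
    (σ : F' ≃ₐ[K] F) (f : F') : (P.comap σ).valuation f = P.valuation (σ f) := rfl

end Place

namespace IsHermitianPair

variable {q : ℕ} {t τ : F}

theorem ne_zero_of_valuation_lt_one (h : IsHermitianPair K q t τ) (hq : 2 ≤ q) (P : Place K F)
    (hPτ : P.valuation τ < 1) : t ≠ 0 := by
  intro ht0
  have h1 : τ * (1 + τ ^ (q - 1)) = 0 := by
    rw [mul_add, mul_one, ← pow_succ', Nat.sub_add_cancel (by omega), add_comm, h.equation, ht0,
      zero_pow (by omega)]
  have hτ : τ = 0 := by
    refine (mul_eq_zero.1 h1).resolve_right fun h2 => ?_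
    have h3 : P.valuation (1 + τ ^ (q - 1)) = 1 := by
      rw [Valuation.map_add_eq_of_lt_left, map_one]
      rw [map_one, map_pow]
      exact pow_lt_one₀ zero_le hPτ (by omega)
    rw [h2, map_zero] at h3
    exact zero_ne_one h3
  have htop := h.adjoin_eq_top
  rw [ht0, hτ, Set.pair_eq_singleton, IntermediateField.adjoin_zero] at htop
  obtain ⟨f, hf⟩ := P.surjective (WithZero.exp 1)
  have hf' : f ∈ (⊥ : IntermediateField K F) := htop ▸ trivial
  obtain ⟨c, rfl⟩ := IntermediateField.mem_bot.1 hf'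
  have := P.valuation_algebraMap_le_one c
  rw [hf, ← WithZero.exp_zero, WithZero.exp_le_exp] at this
  omega

theorem valuation_left (h : IsHermitianPair K q t τ) (hq : 2 ≤ q) (P : Place K F)
    (hPt : P.valuation t < 1) (hPτ : P.valuation τ < 1) :
    P.valuation t = WithZero.exp (-1 : ℤ) :=
  P.valuation_eq_exp_neg_one hPt fun _ hf => by
    obtain ⟨m, n, h1, _⟩ := exists_zpow_valuation hq h.equation h.adjoin_eq_top P P hPt hPτ
      hPt hPτ hf
    exact ⟨m, n, h1⟩

theorem valuation_right (h : IsHermitianPair K q t τ) (hq : 2 ≤ q) (P : Place K F)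
    (hPt : P.valuation t < 1) (hPτ : P.valuation τ < 1) :
    P.valuation τ = WithZero.exp (-(q + 1) : ℤ) := by
  have hτ0 : P.valuation τ ≠ 0 := by
    rw [Valuation.ne_zero_iff]
    rintro rfl
    have := h.equation
    rw [zero_pow (by omega), add_zero, eq_comm, pow_eq_zero_iff (by omega)] at this
    exact h.ne_zero_of_valuation_lt_one hq P hPτ this
  have h1 : P.valuation (τ ^ q + τ) = P.valuation τ := by
    refine P.valuation.map_add_eq_of_lt_right ?_
    rw [map_pow]
    exact pow_lt_self_of_lt_one₀ (zero_lt_iff.2 hτ0) hPτ (by omega)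
  rw [← h1, h.equation, map_pow, h.valuation_left hq P hPt hPτ, ← WithZero.exp_nsmul]
  congr 1
  simp

/-- A place at which `t` and `τ` vanish is rational: up to a power of `t`, every function is a
quotient of elements `c + e` with `c` a nonzero constant and `e` vanishing at the place. -/
theorem isRational (h : IsHermitianPair K q t τ) (hq : 2 ≤ q) (P : Place K F)
    (hPt : P.valuation t < 1) (hPτ : P.valuation τ < 1) : P.IsRational := by
  refine P.isRational_of_exists_const fun f hf => ?_
  have hs : P.valuation (1 + τ ^ (q - 1)) = 1 := by
    rw [Valuation.map_add_eq_of_lt_left, map_one]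
    rw [map_one, map_pow]
    exact pow_lt_one₀ zero_le hPτ (by omega)
  have key : ∀ a ∈ Algebra.adjoin K {t, τ}, a ≠ 0 → ∃ m : ℕ, ∃ c : K, c ≠ 0 ∧ ∃ e,
      P.valuation e < 1 ∧ (1 + τ ^ (q - 1)) ^ m * a = t ^ m * (algebraMap K F c + e) := by
    intro a ha ha0
    have hv0 : P.valuation a ≠ 0 := (P.valuation.ne_zero_iff).2 ha0
    have hle : WithZero.exp (-(((-WithZero.log (P.valuation a)).toNat : ℕ) : ℤ)) ≤
        P.valuation a := by
      conv_rhs => rw [← WithZero.exp_log hv0]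
      rw [WithZero.exp_le_exp]
      omega
    obtain ⟨m, c, hc, b, hb, d, hd, hm⟩ :=
      exists_local_form hq h.equation P hPt hPτ _ a ha ha0 hle
    refine ⟨m, c, hc, t * b + τ * d, P.valuation.map_add_lt ?_ ?_, by rw [hm, add_assoc]⟩
    · rw [map_mul]
      exact mul_lt_one_of_lt_of_le hPt (P.valuation_le_one_of_mem_adjoin hPt.le hPτ.le hb)
    · rw [map_mul]
      exact mul_lt_one_of_lt_of_le hPτ (P.valuation_le_one_of_mem_adjoin hPt.le hPτ.le hd)
  have hunit : ∀ (c : K) (e : F), c ≠ 0 → P.valuation e < 1 →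
      P.valuation (algebraMap K F c + e) = 1 := by
    intro c e hc he
    rw [Valuation.map_add_eq_of_lt_left, P.trivial_on_constants c hc]
    rwa [P.trivial_on_constants c hc]
  have hfm : f ∈ IntermediateField.adjoin K {t, τ} := by rw [h.adjoin_eq_top]; trivial
  obtain ⟨r, hr, s, hs', rfl⟩ := IntermediateField.mem_adjoin_iff_div.1 hfm
  have hr0 : r ≠ 0 := by rintro rfl; simp at hf
  have hs0 : s ≠ 0 := by rintro rfl; simp at hf
  obtain ⟨m, c, hc, e, he, hm⟩ := key r hr hr0
  obtain ⟨n, c', hc', e', he', hn⟩ := key s hs' hs0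
  have hmn : m = n := by
    have h1 := congrArg P.valuation hm
    have h2 := congrArg P.valuation hn
    rw [map_mul, map_mul, map_pow, map_pow, hs, one_pow, one_mul, hunit _ _ ‹_› ‹_›, mul_one,
      h.valuation_left hq P hPt hPτ, ← WithZero.exp_nsmul] at h1 h2
    rw [map_div₀, h1, h2, ← WithZero.exp_sub, WithZero.exp_eq_one] at hf
    simp at hf
    omega
  subst hmn
  have ht0 : t ^ m ≠ 0 := pow_ne_zero _ fun h0 => h.ne_zero_of_valuation_lt_one hq P hPτ h0
  have hε0 : (1 + τ ^ (q - 1)) ^ m ≠ 0 := pow_ne_zero _ fun h0 => by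
    rw [h0, map_zero] at hs
    exact zero_ne_one hs
  have hA : algebraMap K F c' + e' ≠ 0 := fun h0 => by
    have := hunit c' e' hc' he'
    rw [h0, map_zero] at this
    exact zero_ne_one this
  have hc'0 : algebraMap K F c' ≠ 0 := (map_ne_zero _).2 hc'
  refine ⟨c / c', ?_⟩
  have heq : r / s - algebraMap K F (c / c') =
      (algebraMap K F c' * e - algebraMap K F c * e') /
        (algebraMap K F c' * (algebraMap K F c' + e')) := by
    rw [map_div₀, ← mul_div_mul_left r s hε0, hm, hn, mul_div_mul_left _ _ ht0]
    field_simp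
    ring
  rw [heq, map_div₀, map_mul, P.trivial_on_constants c' hc', hunit c' e' hc' he', one_mul, div_one]
  refine P.valuation.map_sub_lt ?_ ?_
  · rwa [map_mul, P.trivial_on_constants c' hc', one_mul]
  · rwa [map_mul, P.trivial_on_constants c hc, one_mul]

end IsHermitianPair

end LocalExpansion

/-! ### Automorphisms of the Hermitian function field -/

section Automorphisms

open Polynomial
open scoped IntermediateField

variable (K : Type*) [Field K] (q : ℕ) [Fact (IsPrimePow q)]

theorem isHermitianPair_hermitian : IsHermitianPair K q (hermitianX K q) (hermitianY K q) :=
  ⟨hermitian_equation K q, adjoin_hermitian_eq_top K q⟩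

theorem aeval_hermitianY (p : K[X]) : aeval (hermitianY K q) p =
    algebraMap (HermitianCoordinateRing K q) (HermitianField K q)
      (AdjoinRoot.of (hermitianPolynomial K q) p) := by
  induction p using Polynomial.induction_on' with
  | add p r hp hr => simp only [map_add, hp, hr]
  | monomial n a =>
    rw [← C_mul_X_pow_eq_monomial]
    simp only [map_mul, map_pow, aeval_X, aeval_C]
    rfl

theorem not_isAlgebraic_hermitianField : ¬ Algebra.IsAlgebraic K (HermitianField K q) := by
  intro h
  obtain ⟨p, hp0, hp⟩ := h.isAlgebraic (hermitianY K q)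
  rw [aeval_hermitianY, FaithfulSMul.algebraMap_eq_zero_iff] at hp
  refine hp0 (AdjoinRoot.of.injective_of_degree_ne_zero ?_ (hp.trans (map_zero _).symm))
  have hdeg : (hermitianPolynomial K q).natDegree = q + 1 := natDegree_X_pow_sub_C
  intro h0
  rw [natDegree_eq_zero_iff_degree_le_zero.2 h0.le] at hdeg
  omega

variable {K q}

namespace IsHermitianPair

variable {t τ : HermitianField K q}

theorem transcendental_left (h : IsHermitianPair K q t τ) : Transcendental K t := fun ht =>
  not_isAlgebraic_hermitianField K q (h.isAlgebraic_of_left (two_le_of_isPrimePow q) ht)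

theorem transcendental_right (h : IsHermitianPair K q t τ) : Transcendental K τ := fun hτ =>
  not_isAlgebraic_hermitianField K q (h.isAlgebraic_of_right (two_le_of_isPrimePow q) hτ)

/-- Every solution of the Hermitian equation that generates the field comes from an automorphism.
The induced homomorphism on the coordinate ring, which is integral over `K[y]`, is injective because
`τ` is transcendental. -/
theorem exists_algEquiv (h : IsHermitianPair K q t τ) :
    ∃ σ : HermitianField K q ≃ₐ[K] HermitianField K q,
      σ (hermitianX K q) = t ∧ σ (hermitianY K q) = τ := by
  let φ : HermitianCoordinateRing K q →ₐ[K] HermitianField K q :=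
    AdjoinRoot.liftAlgHom (hermitianPolynomial K q) (aeval τ) t (by
      rw [eval₂_hermitianPolynomial]
      simp [← h.equation])
  have hφx : φ (AdjoinRoot.root _) = t := AdjoinRoot.liftAlgHom_root ..
  have hφp : ∀ p : K[X], φ (AdjoinRoot.of _ p) = aeval τ p := fun p => AdjoinRoot.liftAlgHom_of ..
  have hinj : Function.Injective φ := by
    rw [injective_iff_map_eq_zero]
    have hmonic : (hermitianPolynomial K q).Monic := monic_X_pow_sub_C _ (by omega)
    have hint : Algebra.IsIntegral K[X] (HermitianCoordinateRing K q) :=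
      have := (AdjoinRoot.powerBasis' hmonic).finite
      Algebra.IsIntegral.of_finite _ _
    have hbot : RingHom.ker (φ : HermitianCoordinateRing K q →+* HermitianField K q) = ⊥ := by
      refine Ideal.eq_bot_of_comap_eq_bot (R := K[X]) ?_
      rw [eq_bot_iff]
      intro p hp
      have hp' : φ (AdjoinRoot.of _ p) = 0 := hp
      rw [hφp] at hp'
      by_contra hne
      exact h.transcendental_right ⟨p, hne, hp'⟩
    intro a ha
    have : a ∈ RingHom.ker (φ : HermitianCoordinateRing K q →+* HermitianField K q) := ha
    rwa [hbot] at this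
  let ψ : HermitianField K q →ₐ[K] HermitianField K q := IsFractionRing.liftAlgHom hinj
  have hψ : ∀ r, ψ (algebraMap _ _ r) = φ r := fun r => IsFractionRing.lift_algebraMap hinj r
  have hψx : ψ (hermitianX K q) = t := (hψ _).trans hφx
  have hψy : ψ (hermitianY K q) = τ := by
    refine (hψ _).trans ((hφp X).trans (aeval_X τ))
  have hsurj : Function.Surjective ψ := by
    rw [← AlgHom.fieldRange_eq_top, eq_top_iff, ← h.adjoin_eq_top,
      IntermediateField.adjoin_le_iff]
    rintro z (rfl | rfl)
    · exact ⟨_, hψx⟩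
    · exact ⟨_, hψy⟩
  exact ⟨AlgEquiv.ofBijective ψ ⟨ψ.injective, hsurj⟩, hψx, hψy⟩

/-- A generating solution of the Hermitian equation stays one after an affine change
`(t, τ) ↦ (t - a, τ - b - a ^ q (t - a))` centred at a point `(a, b)` of the curve. -/
theorem translate [Fact (Nat.card K = q ^ 2)] (h : IsHermitianPair K q t τ) {a b : K}
    (hab : b ^ q + b = a ^ (q + 1)) :
    IsHermitianPair K q (t - algebraMap K _ a)
      (τ - algebraMap K _ b - algebraMap K _ a ^ q * (t - algebraMap K _ a)) := by
  have haq : ((algebraMap K (HermitianField K q) a) ^ q) ^ q = algebraMap K _ a := by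
    rw [← map_pow, ← map_pow, pow_pow_of_card]
  have hab' := congrArg (algebraMap K (HermitianField K q)) hab
  rw [map_add, map_pow, map_pow] at hab'
  constructor
  · rw [pow_succ (t - _), sub_pow_of_card K q (τ - _), mul_pow, haq, sub_pow_of_card K q τ,
      sub_pow_of_card K q t]
    linear_combination h.equation - hab'
  · rw [eq_top_iff, ← h.adjoin_eq_top, IntermediateField.adjoin_le_iff]
    set S := IntermediateField.adjoin K {t - algebraMap K _ a,
      τ - algebraMap K _ b - algebraMap K _ a ^ q * (t - algebraMap K _ a)}
    have h1 : t - algebraMap K _ a ∈ S := IntermediateField.subset_adjoin _ _ (by simp)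
    have h2 : τ - algebraMap K _ b - algebraMap K _ a ^ q * (t - algebraMap K _ a) ∈ S :=
      IntermediateField.subset_adjoin _ _ (by simp)
    have h3 : algebraMap K _ a ∈ S := S.algebraMap_mem a
    have h4 : algebraMap K _ b ∈ S := S.algebraMap_mem b
    rintro z (rfl | rfl)
    · simpa using S.add_mem h1 h3
    · simpa using S.add_mem (S.add_mem h2 (S.mul_mem (pow_mem h3 q) h1)) h4

/-- The Hermitian equation is preserved by the change of coordinates `(x, y) ↦ (x / y, 1 / y)`,
which exchanges the origin with the point at infinity. -/
theorem invert (h : IsHermitianPair K q t τ) : IsHermitianPair K q (t / τ) τ⁻¹ := by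
  have hτ0 : τ ≠ 0 := fun h0 => h.transcendental_right (h0 ▸ isAlgebraic_zero)
  constructor
  · rw [div_pow, ← h.equation, inv_pow]
    field_simp
    ring
  · rw [eq_top_iff, ← h.adjoin_eq_top, IntermediateField.adjoin_le_iff]
    set S := IntermediateField.adjoin K {t / τ, τ⁻¹}
    have h1 : t / τ ∈ S := IntermediateField.subset_adjoin _ _ (by simp)
    have h2 : τ⁻¹ ∈ S := IntermediateField.subset_adjoin _ _ (by simp)
    have h3 : τ ∈ S := by simpa using S.inv_mem h2
    rintro z (rfl | rfl)
    · simpa [hτ0] using S.mul_mem h1 h3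
    · exact h3

end IsHermitianPair

/-- Away from the point at infinity both coordinates are regular. -/
theorem Place.valuation_hermitianY_le_one (P : Place K (HermitianField K q))
    (h : P.valuation (hermitianX K q) ≤ 1) : P.valuation (hermitianY K q) ≤ 1 := by
  have hq := two_le_of_isPrimePow q
  by_contra hlt
  rw [not_le] at hlt
  have hv := congrArg P.valuation (hermitian_equation K q)
  have h3 : P.valuation (hermitianY K q) < P.valuation (hermitianY K q ^ q) := by
    rw [map_pow]
    exact lt_self_pow₀ hlt (by omega)
  rw [Valuation.map_add_eq_of_lt_left _ h3, map_pow, map_pow] at hv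
  have h4 : P.valuation (hermitianX K q) ^ (q + 1) ≤ 1 := pow_le_one' h _
  rw [← hv] at h4
  exact absurd (one_lt_pow₀ hlt (by omega)) (not_lt.2 h4)

end Automorphisms

/-! ### Orders at a place -/

section Orders

open Polynomial

variable {K F : Type*} [Field K] [Field F] [Algebra K F]

namespace Place

/-- The order `v_P(f)` of an arbitrary element, with the junk value `0` at `f = 0`. -/
noncomputable def order (P : Place K F) (f : F) : ℤ :=
  -WithZero.log (P.valuation f)

variable (P : Place K F) {f g : F}

theorem order_eq_of_valuation_eq {n : ℤ} (h : P.valuation f = WithZero.exp n) :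
    P.order f = -n := by
  rw [order, h, WithZero.log_exp]

theorem order_eq_zero_of_valuation_eq (h : P.valuation f = 1) : P.order f = 0 := by
  rw [order, h, WithZero.log_one, neg_zero]

theorem valuation_eq_exp_order (hf : f ≠ 0) : P.valuation f = WithZero.exp (-P.order f) := by
  rw [order, neg_neg, WithZero.exp_log ((P.valuation.ne_zero_iff).2 hf)]

theorem order_mul (hf : f ≠ 0) (hg : g ≠ 0) : P.order (f * g) = P.order f + P.order g := by
  rw [order, map_mul, WithZero.log_mul ((P.valuation.ne_zero_iff).2 hf)
    ((P.valuation.ne_zero_iff).2 hg), order, order]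
  ring

theorem order_inv : P.order f⁻¹ = -P.order f := by
  rw [order, map_inv₀, WithZero.log_inv, order]

theorem order_pow (n : ℕ) : P.order (f ^ n) = n * P.order f := by
  rw [order, map_pow, WithZero.log_pow, order]
  simp

theorem order_prod {ι : Type*} (s : Finset ι) (u : ι → F) (hu : ∀ i ∈ s, u i ≠ 0) :
    P.order (∏ i ∈ s, u i) = ∑ i ∈ s, P.order (u i) := by
  classical
  induction s using Finset.induction_on with
  | empty => simp [order]
  | insert i s hi ih =>
    rw [Finset.prod_insert hi, Finset.sum_insert hi, P.order_mul (hu i (by simp))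
      (Finset.prod_ne_zero_iff.2 fun j hj => hu j (by simp [hj])),
      ih fun j hj => hu j (by simp [hj])]

theorem valuation_le_one_iff (hf : f ≠ 0) : P.valuation f ≤ 1 ↔ 0 ≤ P.order f := by
  rw [P.valuation_eq_exp_order hf, ← WithZero.exp_zero, WithZero.exp_le_exp]
  omega

theorem valuation_lt_one_iff (hf : f ≠ 0) : P.valuation f < 1 ↔ 0 < P.order f := by
  rw [P.valuation_eq_exp_order hf, ← WithZero.exp_zero, WithZero.exp_lt_exp]
  omega

/-- The value of a function at a place is unique. -/
theorem const_unique {a b : K} (ha : P.valuation (f - algebraMap K F a) < 1)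
    (hb : P.valuation (f - algebraMap K F b) < 1) : a = b := by
  by_contra hne
  have h1 := P.trivial_on_constants (b - a) (sub_ne_zero.2 (Ne.symm hne))
  have h2 := P.valuation.map_sub_lt ha hb
  rw [sub_sub_sub_cancel_left, ← map_sub, h1] at h2
  exact lt_irrefl _ h2

theorem valuation_le_one_of_const {a : K} (ha : P.valuation (f - algebraMap K F a) < 1) :
    P.valuation f ≤ 1 := by
  have := P.valuation.map_add_le ha.le (P.valuation_algebraMap_le_one a)
  rwa [sub_add_cancel] at this

theorem valuation_sub_eq_one {a b : K} (ha : P.valuation (f - algebraMap K F a) < 1)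
    (hab : b ≠ a) : P.valuation (f - algebraMap K F b) = 1 := by
  refine le_antisymm ?_ (not_lt.1 fun hb => hab (P.const_unique hb ha))
  exact (P.valuation.map_sub_le (P.valuation_le_one_of_const ha)
    (P.valuation_algebraMap_le_one b))

theorem valuation_aeval_le_one (hf : P.valuation f ≤ 1) (p : K[X]) :
    P.valuation (aeval f p) ≤ 1 := by
  refine P.valuation_le_one_of_mem_adjoin hf hf (a := aeval f p) ?_
  rw [Set.pair_eq_singleton]
  exact aeval_mem_adjoin_singleton K f

theorem order_aeval_of_const {a : K} (ha : P.valuation (f - algebraMap K F a) < 1) {p : K[X]}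
    (hp : p ≠ 0) : P.order (aeval f p) = p.rootMultiplicity a * P.order (f - algebraMap K F a) := by
  obtain ⟨r, hr, hndvd⟩ := exists_eq_pow_rootMultiplicity_mul_and_not_dvd p hp a
  have hr0 : r.eval a ≠ 0 := fun h0 => hndvd (dvd_iff_isRoot.2 h0)
  have h1 : P.valuation (aeval f r) = 1 := by
    obtain ⟨s, hs⟩ : X - C a ∣ r - C (r.eval a) := by
      rw [dvd_iff_isRoot]
      simp
    have h2 : aeval f r = algebraMap K F (r.eval a) + (f - algebraMap K F a) * aeval f s := by
      have := congrArg (aeval f) hs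
      simp only [map_sub, map_mul, aeval_X, aeval_C] at this
      linear_combination this
    have h3 : P.valuation ((f - algebraMap K F a) * aeval f s) < 1 := by
      rw [map_mul]
      exact mul_lt_one_of_lt_of_le ha
        (P.valuation_aeval_le_one (P.valuation_le_one_of_const ha) s)
    rw [h2, Valuation.map_add_eq_of_lt_left, P.trivial_on_constants _ hr0]
    rwa [P.trivial_on_constants _ hr0]
  have h2 : P.valuation (aeval f p) =
      P.valuation ((f - algebraMap K F a) ^ p.rootMultiplicity a) := by
    conv_lhs => rw [hr]
    simp only [map_mul, map_pow, map_sub, aeval_X, aeval_C, h1, mul_one]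
  rw [← order_pow, order, order, h2]

theorem order_aeval_of_pole (hf : 1 < P.valuation f) {p : K[X]} (hp : p ≠ 0) :
    P.order (aeval f p) = p.natDegree * P.order f := by
  have : P.valuation.IsTrivialOn K := ⟨P.trivial_on_constants⟩
  rw [← order_pow, order, order, map_pow,
    valuation_aeval_eq_valuation_X_pow_natDegree_of_one_lt_valuation_X f hf hp]

end Place

end Orders

/-! ### The rational places of the Hermitian function field -/

section Places

open Polynomial
open scoped IntermediateField

variable (K : Type*) [Field K] (q : ℕ)

/-- The affine points of the Hermitian curve with coordinates in `K`. -/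
abbrev AffinePoint : Type _ :=
  {p : K × K // p.2 ^ q + p.2 = p.1 ^ (q + 1)}

theorem pow_succ_pow_of_card {K : Type*} [Field K] (q : ℕ) [Fact (IsPrimePow q)]
    [Fact (Nat.card K = q ^ 2)] (a : K) : (a ^ (q + 1)) ^ q = a ^ (q + 1) := by
  have h := pow_pow_of_card q a
  rw [← pow_mul, mul_comm, pow_mul, pow_succ, h, pow_succ, mul_comm]

variable [Fact (IsPrimePow q)] [hK : Fact (Nat.card K = q ^ 2)]

noncomputable instance : Fintype (AffinePoint K q) :=
  have := finite_of_card K q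
  Fintype.ofFinite _

theorem card_affinePoint : Fintype.card (AffinePoint K q) = q ^ 3 := by
  have := finite_of_card K q
  have := Fintype.ofFinite K
  let e : AffinePoint K q ≃ Σ a : K, {b : K | b ^ q + b = a ^ (q + 1)} :=
    { toFun := fun p => ⟨p.1.1, p.1.2, p.2⟩
      invFun := fun s => ⟨(s.1, s.2.1), s.2.2⟩
      left_inv := fun _ => rfl
      right_inv := fun _ => rfl }
  rw [← Nat.card_eq_fintype_card, Nat.card_congr e, Nat.card_sigma]
  simp_rw [Nat.card_coe_set_eq]
  rw [Finset.sum_congr rfl fun a _ => ncard_trace_fiber q (pow_succ_pow_of_card q a),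
    Finset.sum_const,
    Finset.card_univ, ← Nat.card_eq_fintype_card, hK.out, smul_eq_mul]
  ring

variable {K q}

theorem trace_sub_eq_prod {F : Type*} [Field F] [Algebra K F] {c : K} (hc : c ^ q = c) (z : F) :
    ∃ s : Finset K, (∀ b ∈ s, b ^ q + b = c) ∧
      z ^ q + z - algebraMap K F c = ∏ b ∈ s, (z - algebraMap K F b) := by
  classical
  have hq := two_le_of_isPrimePow q
  have := finite_of_card K q
  have hdeg : (X ^ q + (X - C c) : K[X]).natDegree = q := by
    rw [natDegree_add_eq_left_of_natDegree_lt] <;> simp; omega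
  have hmonic : (X ^ q + (X - C c) : K[X]).Monic := monic_X_pow_add (by
    rw [degree_X_sub_C]
    exact_mod_cast hq)
  have hcard := Set.ncard_eq_toFinset_card {b : K | b ^ q + b = c} (Set.toFinite _)
  rw [ncard_trace_fiber q hc] at hcard
  refine ⟨(Set.toFinite {b : K | b ^ q + b = c}).toFinset, fun b hb => by simpa using hb, ?_⟩
  rw [← aeval_eq_prod_of_natDegree_le_card hmonic _ (by omega)]
  · simp [add_sub_assoc]
  · intro b hb
    have hb' : b ^ q + b = c := by simpa using hb
    simp [← add_sub_assoc, hb']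

theorem norm_sub_eq_prod {F : Type*} [Field F] [Algebra K F] {e : K} (he : e ^ q = e)
    (he0 : e ≠ 0) (z : F) : ∃ s : Finset K, (∀ b ∈ s, b ^ (q + 1) = e) ∧
      z ^ (q + 1) - algebraMap K F e = ∏ b ∈ s, (z - algebraMap K F b) := by
  classical
  have := finite_of_card K q
  have hcard := Set.ncard_eq_toFinset_card {b : K | b ^ (q + 1) = e} (Set.toFinite _)
  rw [ncard_norm_fiber q he he0] at hcard
  refine ⟨(Set.toFinite {b : K | b ^ (q + 1) = e}).toFinset, fun b hb => by simpa using hb, ?_⟩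
  rw [← aeval_eq_prod_of_natDegree_le_card (monic_X_pow_sub_C e (by omega : q + 1 ≠ 0)) _
    (by rw [natDegree_X_pow_sub_C]; omega)]
  · simp
  · intro b hb
    have hb' : b ^ (q + 1) = e := by simpa using hb
    simp [hb']

theorem Place.exists_factor_lt_one {F : Type*} [Field F] [Algebra K F] (P : Place K F)
    {s : Finset K} {z : F} (h : P.valuation (∏ b ∈ s, (z - algebraMap K F b)) < 1) :
    ∃ b ∈ s, P.valuation (z - algebraMap K F b) < 1 := by
  by_contra! hne
  rw [map_prod] at h
  exact absurd h (not_lt.2 (Finset.one_le_prod' hne))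

/-- The functions `t` and `τ` have a common zero. At a zero of `t` some `τ - β` with
`β ^ q + β = 0` vanishes, and an automorphism moves it to `τ`. -/
theorem IsHermitianPair.exists_place {t τ : HermitianField K q} (h : IsHermitianPair K q t τ) :
    ∃ P : Place K (HermitianField K q), P.valuation t < 1 ∧ P.valuation τ < 1 := by
  have hq := two_le_of_isPrimePow q
  obtain ⟨hfin, hgal⟩ := h.isGalois
  obtain ⟨P, hP⟩ := exists_place_valuation_lt_one h.transcendental_left
  obtain ⟨s, hs, hprod⟩ := trace_sub_eq_prod (K := K) (q := q) (c := 0)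
    (zero_pow (by omega)) τ
  rw [map_zero, sub_zero, h.equation] at hprod
  obtain ⟨β, hβ, hPβ⟩ := P.exists_factor_lt_one (s := s) (z := τ) (by
    rw [← hprod, map_pow]
    exact pow_lt_one₀ zero_le hP (by omega))
  have h' := h.translate (a := 0) (b := β) (by rw [hs β hβ, zero_pow (by omega)])
  obtain ⟨σ, hσx, hσy⟩ := h'.exists_algEquiv
  obtain ⟨ρ, hρx, hρy⟩ := h.exists_algEquiv
  refine ⟨P.comap (ρ.symm.trans σ), ?_, ?_⟩
  · rw [Place.comap_valuation, AlgEquiv.trans_apply, ← hρx, ρ.symm_apply_apply, hσx]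
    simpa using hP
  · rw [Place.comap_valuation, AlgEquiv.trans_apply, ← hρy, ρ.symm_apply_apply, hσy]
    have : q ≠ 0 := by omega
    simpa [this] using hPβ

/-- At an affine point `(a, b)`, the local parameter `x - a` and the equation of the tangent line
satisfy the Hermitian equation. -/
theorem AffinePoint.isHermitianPair (p : AffinePoint K q) :
    IsHermitianPair K q (hermitianX K q - algebraMap K _ p.1.1)
      (hermitianY K q - algebraMap K _ p.1.2 - algebraMap K _ p.1.1 ^ q *
        (hermitianX K q - algebraMap K _ p.1.1)) :=
  (isHermitianPair_hermitian K q).translate p.2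

/-- The rational place at an affine point of the Hermitian curve. -/
noncomputable def affinePlace (p : AffinePoint K q) : RationalPlace K (HermitianField K q) :=
  ⟨p.isHermitianPair.exists_place.choose,
    p.isHermitianPair.isRational (two_le_of_isPrimePow q) _
      p.isHermitianPair.exists_place.choose_spec.1 p.isHermitianPair.exists_place.choose_spec.2⟩

variable (K q) in
/-- The rational place at infinity of the Hermitian curve, where `x / y` is a local parameter. -/
noncomputable def infinitePlace : RationalPlace K (HermitianField K q) :=
  ⟨(isHermitianPair_hermitian K q).invert.exists_place.choose,
    (isHermitianPair_hermitian K q).invert.isRational (two_le_of_isPrimePow q) _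
      (isHermitianPair_hermitian K q).invert.exists_place.choose_spec.1
      (isHermitianPair_hermitian K q).invert.exists_place.choose_spec.2⟩

theorem affinePlace_local (p : AffinePoint K q) :
    (affinePlace p).1.valuation (hermitianX K q - algebraMap K _ p.1.1) < 1 ∧
      (affinePlace p).1.valuation (hermitianY K q - algebraMap K _ p.1.2 -
        algebraMap K _ p.1.1 ^ q * (hermitianX K q - algebraMap K _ p.1.1)) < 1 :=
  p.isHermitianPair.exists_place.choose_spec

theorem affinePlace_x (p : AffinePoint K q) :
    (affinePlace p).1.valuation (hermitianX K q - algebraMap K _ p.1.1) < 1 :=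
  (affinePlace_local p).1

theorem affinePlace_y (p : AffinePoint K q) :
    (affinePlace p).1.valuation (hermitianY K q - algebraMap K _ p.1.2) < 1 := by
  have h1 : (affinePlace p).1.valuation (algebraMap K _ p.1.1 ^ q *
      (hermitianX K q - algebraMap K _ p.1.1)) < 1 := by
    rw [mul_comm, map_mul, map_pow]
    exact mul_lt_one_of_lt_of_le (affinePlace_x p)
      (pow_le_one' (Place.valuation_algebraMap_le_one _ _) q)
  have h2 := (affinePlace p).1.valuation.map_add_lt (affinePlace_local p).2 h1
  rwa [sub_add_cancel] at h2

theorem infinitePlace_local :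
    (infinitePlace K q).1.valuation (hermitianX K q / hermitianY K q) < 1 ∧
      (infinitePlace K q).1.valuation (hermitianY K q)⁻¹ < 1 :=
  (isHermitianPair_hermitian K q).invert.exists_place.choose_spec

theorem valuation_hermitianY_infinitePlace :
    (infinitePlace K q).1.valuation (hermitianY K q) = WithZero.exp (q + 1 : ℤ) := by
  have h := (isHermitianPair_hermitian K q).invert.valuation_right (two_le_of_isPrimePow q)
    (infinitePlace K q).1 infinitePlace_local.1 infinitePlace_local.2
  rw [map_inv₀, WithZero.exp_neg] at h
  exact inv_injective h

theorem valuation_hermitianX_infinitePlace :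
    (infinitePlace K q).1.valuation (hermitianX K q) = WithZero.exp (q : ℤ) := by
  have h := (isHermitianPair_hermitian K q).invert.valuation_left (two_le_of_isPrimePow q)
    (infinitePlace K q).1 infinitePlace_local.1 infinitePlace_local.2
  rw [map_div₀, valuation_hermitianY_infinitePlace, div_eq_iff WithZero.exp_ne_zero,
    ← WithZero.exp_add] at h
  rw [h]
  congr 1
  ring

theorem one_lt_valuation_hermitianX_infinitePlace :
    1 < (infinitePlace K q).1.valuation (hermitianX K q) := by
  have := two_le_of_isPrimePow q
  rw [valuation_hermitianX_infinitePlace, ← WithZero.exp_zero, WithZero.exp_lt_exp]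
  omega

theorem Place.eq_infinitePlace (P : Place K (HermitianField K q))
    (h : 1 < P.valuation (hermitianX K q)) : P = (infinitePlace K q).1 :=
  Place.eq_of_pole K q P _ h one_lt_valuation_hermitianX_infinitePlace

/-- A place at which `x` takes a value `a` in `K` is the place of an affine point: the equation
`y ^ q + y = a ^ (q + 1)` splits into linear factors over `K`. -/
theorem Place.eq_affinePlace (P : Place K (HermitianField K q)) {a : K}
    (h : P.valuation (hermitianX K q - algebraMap K _ a) < 1) :
    ∃ p : AffinePoint K q, p.1.1 = a ∧ P = (affinePlace p).1 := by
  obtain ⟨s, hs, hprod⟩ := trace_sub_eq_prod (pow_succ_pow_of_card q a) (hermitianY K q)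
  rw [hermitian_equation, map_pow] at hprod
  obtain ⟨b, hb, hPb⟩ := P.exists_factor_lt_one (s := s) (z := hermitianY K q) (by
    rw [← hprod]
    exact P.valuation_pow_sub_pow_lt (P.valuation_le_one_of_const h)
      (P.valuation_algebraMap_le_one a) h _)
  exact ⟨⟨(a, b), hs b hb⟩, rfl, Place.eq_of_finite_point K q P _ a b h hPb
    (affinePlace_x ⟨(a, b), hs b hb⟩) (affinePlace_y ⟨(a, b), hs b hb⟩)⟩

/-- The rational place at a point of the projective Hermitian curve, `none` being the point at
infinity. -/
noncomputable def pointPlace : Option (AffinePoint K q) → RationalPlace K (HermitianField K q)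
  | none => infinitePlace K q
  | some p => affinePlace p

theorem pointPlace_bijective : Function.Bijective (pointPlace (K := K) (q := q)) := by
  have hne : ∀ p : AffinePoint K q, infinitePlace K q ≠ affinePlace p := fun p h => by
    have h1 := (affinePlace p).1.valuation_le_one_of_const (affinePlace_x p)
    rw [← h] at h1
    exact absurd one_lt_valuation_hermitianX_infinitePlace (not_lt.2 h1)
  constructor
  · rintro (_ | p) (_ | p') h
    · rfl
    · exact absurd h (hne p')
    · exact absurd h.symm (hne p)
    · have h' : affinePlace p = affinePlace p' := h
      congr 1
      ext
      · exact Place.const_unique _ (affinePlace_x p) (h' ▸ affinePlace_x p')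
      · exact Place.const_unique _ (affinePlace_y p) (h' ▸ affinePlace_y p')
  · intro P
    by_cases hP : P.1.valuation (hermitianX K q) ≤ 1
    · obtain ⟨a, ha⟩ := P.2.exists_const hP
      obtain ⟨p, _, hp⟩ := P.1.eq_affinePlace ha
      exact ⟨some p, Subtype.ext hp.symm⟩
    · exact ⟨none, Subtype.ext (P.1.eq_infinitePlace (not_le.1 hP)).symm⟩

variable (K q) in
/-- The rational places of the Hermitian function field are the rational points of the projective
curve. -/
noncomputable def pointEquiv : Option (AffinePoint K q) ≃ RationalPlace K (HermitianField K q) :=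
  Equiv.ofBijective pointPlace pointPlace_bijective

@[simp]
theorem pointEquiv_none : pointEquiv K q none = infinitePlace K q := rfl

@[simp]
theorem pointEquiv_some (p : AffinePoint K q) : pointEquiv K q (some p) = affinePlace p := rfl

variable (K q) in
theorem card_rationalPlace :
    Fintype.card (RationalPlace K (HermitianField K q)) = q ^ 3 + 1 := by
  rw [← Fintype.card_congr (pointEquiv K q), Fintype.card_option, card_affinePoint]

end Places

/-! ### The Galois group over `K(x)` -/

section Galois

open Polynomial
open scoped IntermediateField

variable {K : Type*} [Field K] {q : ℕ} [Fact (IsPrimePow q)]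

theorem IsHermitianPair.algHom_ext {F F' : Type*} [Field F] [Field F'] [Algebra K F]
    [Algebra K F'] {q : ℕ} {t τ : F} (h : IsHermitianPair K q t τ) {f g : F →ₐ[K] F'}
    (ht : f t = g t) (hτ : f τ = g τ) : f = g := by
  have hadj : ∀ a ∈ Algebra.adjoin K {t, τ}, f a = g a := by
    intro a ha
    refine AlgHom.adjoin_le_equalizer f g ?_ ha
    rintro z (rfl | rfl)
    · exact ht
    · exact hτ
  ext z
  have hz : z ∈ IntermediateField.adjoin K {t, τ} := by rw [h.adjoin_eq_top]; trivial
  obtain ⟨r, hr, s, hs, rfl⟩ := IntermediateField.mem_adjoin_iff_div.1 hz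
  rw [map_div₀, map_div₀, hadj r hr, hadj s hs]

theorem IsHermitianPair.exists_algEquiv_apply_left {t τ τ' : HermitianField K q}
    (h : IsHermitianPair K q t τ) (h' : IsHermitianPair K q t τ') :
    ∃ σ : HermitianField K q ≃ₐ[K⟮t⟯] HermitianField K q, σ τ = τ' := by
  obtain ⟨σ, hσx, hσy⟩ := h'.exists_algEquiv
  obtain ⟨ρ, hρx, hρy⟩ := h.exists_algEquiv
  let ε := ρ.symm.trans σ
  have hε : ε t = t := by
    change σ (ρ.symm t) = t
    rw [← hρx, ρ.symm_apply_apply, hσx, hρx]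
  have hmem : ε ∈ IntermediateField.fixingSubgroup K⟮t⟯ := by
    rw [IntermediateField.mem_fixingSubgroup_iff]
    refine (IntermediateField.forall_mem_adjoin_smul_eq_self_iff K ε).2 fun z hz => ?_
    rw [Set.mem_singleton_iff.1 hz]
    exact hε
  refine ⟨IntermediateField.fixingSubgroupEquiv K⟮t⟯ ⟨ε, hmem⟩, ?_⟩
  change σ (ρ.symm τ) = τ'
  rw [← hρy, ρ.symm_apply_apply, hσy]

theorem hermitianX_sub_ne_zero (a : K) : hermitianX K q - algebraMap K _ a ≠ 0 := fun h0 =>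
  (isHermitianPair_hermitian K q).transcendental_left (by
    rw [sub_eq_zero.1 h0]
    exact isAlgebraic_algebraMap a)

variable [hK : Fact (Nat.card K = q ^ 2)]

theorem order_hermitianX_sub_self (p : AffinePoint K q) :
    (affinePlace p).1.order (hermitianX K q - algebraMap K _ p.1.1) = 1 := by
  rw [Place.order_eq_of_valuation_eq _ (p.isHermitianPair.valuation_left (two_le_of_isPrimePow q)
    (affinePlace p).1 (affinePlace_local p).1 (affinePlace_local p).2), neg_neg]

theorem order_hermitianX_sub_of_ne (p : AffinePoint K q) {a : K} (ha : a ≠ p.1.1) :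
    (affinePlace p).1.order (hermitianX K q - algebraMap K _ a) = 0 :=
  Place.order_eq_zero_of_valuation_eq _
    ((affinePlace p).1.valuation_sub_eq_one (affinePlace_x p) ha)

theorem order_hermitianX_infinitePlace :
    (infinitePlace K q).1.order (hermitianX K q) = -q :=
  Place.order_eq_of_valuation_eq _ valuation_hermitianX_infinitePlace

theorem valuation_hermitianX_sub_infinitePlace (a : K) :
    (infinitePlace K q).1.valuation (hermitianX K q - algebraMap K _ a) =
      WithZero.exp (q : ℤ) := by
  rw [Valuation.map_sub_eq_of_lt_left, valuation_hermitianX_infinitePlace]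
  exact (Place.valuation_algebraMap_le_one _ a).trans_lt one_lt_valuation_hermitianX_infinitePlace

theorem order_hermitianX_sub_infinitePlace (a : K) :
    (infinitePlace K q).1.order (hermitianX K q - algebraMap K _ a) = -q :=
  Place.order_eq_of_valuation_eq _ (valuation_hermitianX_sub_infinitePlace a)

/-- The Galois group of `H / K(x)` permutes the points with a given abscissa simply transitively. -/
theorem exists_galois_bijective (p₀ : AffinePoint K q) :
    ∃ σ : {p : AffinePoint K q // p.1.1 = p₀.1.1} →
        (HermitianField K q ≃ₐ[K⟮hermitianX K q⟯] HermitianField K q),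
      Function.Bijective σ ∧
        ∀ p, (affinePlace p₀).1.comap ((σ p).restrictScalars K) = (affinePlace p.1).1 := by
  have hH := isHermitianPair_hermitian K q
  have hq := two_le_of_isPrimePow q
  have hq0 : q ≠ 0 := by omega
  have hroot : ∀ p : {p : AffinePoint K q // p.1.1 = p₀.1.1},
      (p₀.1.2 - p.1.1.2) ^ q + (p₀.1.2 - p.1.1.2) = (0 : K) ^ (q + 1) := by
    intro p
    have h1 := p.1.2
    have h2 := p₀.2
    rw [p.2] at h1
    rw [sub_pow_of_card K q, zero_pow (by omega)]
    linear_combination h2 - h1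
  have hex : ∀ p : {p : AffinePoint K q // p.1.1 = p₀.1.1},
      ∃ σ : HermitianField K q ≃ₐ[K⟮hermitianX K q⟯] HermitianField K q,
        σ (hermitianY K q) = hermitianY K q - algebraMap K _ (p₀.1.2 - p.1.1.2) := by
    intro p
    refine hH.exists_algEquiv_apply_left ?_
    simpa [hq0] using hH.translate (hroot p)
  choose σ hσ using hex
  have hx : ∀ ρ : HermitianField K q ≃ₐ[K⟮hermitianX K q⟯] HermitianField K q,
      ρ (hermitianX K q) = hermitianX K q := fun ρ =>
    ρ.commutes (IntermediateField.AdjoinSimple.gen K (hermitianX K q))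
  have hK' : ∀ (ρ : HermitianField K q ≃ₐ[K⟮hermitianX K q⟯] HermitianField K q) (c : K),
      ρ (algebraMap K _ c) = algebraMap K _ c := fun ρ c => (ρ.restrictScalars K).commutes c
  have hext : ∀ ρ ρ' : HermitianField K q ≃ₐ[K⟮hermitianX K q⟯] HermitianField K q,
      ρ (hermitianY K q) = ρ' (hermitianY K q) → ρ = ρ' := fun ρ ρ' h =>
    AlgEquiv.restrictScalars_injective K (AlgEquiv.ext fun z =>
      DFunLike.congr_fun (hH.algHom_ext (f := (ρ.restrictScalars K).toAlgHom)
        (g := (ρ'.restrictScalars K).toAlgHom) ((hx ρ).trans (hx ρ').symm) h) z)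
  refine ⟨σ, ⟨fun p p' h => ?_, fun ρ => ?_⟩, fun p => ?_⟩
  · have h1 := hσ p
    rw [h, hσ p'] at h1
    have h2 := (algebraMap K (HermitianField K q)).injective (sub_right_injective h1)
    ext
    · rw [p.2, p'.2]
    · exact (sub_right_injective h2).symm
  · have hρ : (affinePlace p₀).1.valuation (ρ (hermitianX K q) - algebraMap K _ p₀.1.1) < 1 := by
      rw [hx]
      exact affinePlace_x p₀
    obtain ⟨p, hp, hPp⟩ := ((affinePlace p₀).1.comap (ρ.restrictScalars K)).eq_affinePlace
      (a := p₀.1.1) (by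
        rw [Place.comap_valuation, map_sub, AlgEquiv.commutes]
        exact hρ)
    have hy := affinePlace_y p
    rw [← hPp, Place.comap_valuation, map_sub, AlgEquiv.commutes] at hy
    obtain ⟨s, hs, hprod⟩ := trace_sub_eq_prod (K := K) (q := q) (c := 0)
      (zero_pow (by omega)) (ρ (hermitianY K q) - hermitianY K q)
    have h0 : (ρ (hermitianY K q) - hermitianY K q) ^ q +
        (ρ (hermitianY K q) - hermitianY K q) = 0 := by
      have h1 := congrArg ρ hH.equation
      rw [map_add, map_pow, map_pow, hx, ← hH.equation] at h1
      rw [sub_pow_of_card K q]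
      linear_combination h1
    rw [h0, map_zero, sub_zero, eq_comm, Finset.prod_eq_zero_iff] at hprod
    obtain ⟨β, _, hβ⟩ := hprod
    have hβ' : ρ (hermitianY K q) = hermitianY K q + algebraMap K _ β := by
      linear_combination hβ
    have hc : p.1.2 = p₀.1.2 + β := by
      refine (affinePlace p₀).1.const_unique (f := ρ (hermitianY K q)) hy ?_
      rw [hβ', map_add, add_sub_add_right_eq_sub]
      exact affinePlace_y p₀
    refine ⟨⟨p, hp⟩, hext _ _ ?_⟩
    rw [hσ, hβ', hc]
    simp
  · refine Place.eq_of_finite_point K q _ _ p.1.1.1 p.1.1.2 ?_ ?_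
      (affinePlace_x _) (affinePlace_y _)
    · rw [Place.comap_valuation, map_sub, AlgEquiv.commutes, p.2]
      change (affinePlace p₀).1.valuation ((σ p) _ - _) < 1
      rw [hx]
      exact affinePlace_x p₀
    · have : (σ p) (hermitianY K q - algebraMap K _ p.1.1.2) =
          hermitianY K q - algebraMap K _ p₀.1.2 := by
        rw [map_sub, hσ, hK', map_sub]
        ring
      rw [Place.comap_valuation]
      change (affinePlace p₀).1.valuation ((σ p) _) < 1
      rw [this]
      exact affinePlace_y p₀

end Galois

/-! ### Zeros are bounded by poles -/

section DegreeBound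

open Polynomial
open scoped IntermediateField

variable {K : Type*} [Field K] {q : ℕ} [Fact (IsPrimePow q)] [hK : Fact (Nat.card K = q ^ 2)]

theorem sum_rationalPlace {M : Type*} [AddCommMonoid M]
    (u : RationalPlace K (HermitianField K q) → M) :
    ∑ P, u P = u (infinitePlace K q) + ∑ p : AffinePoint K q, u (affinePlace p) := by
  rw [← (pointEquiv K q).sum_comp, Fintype.sum_option]
  rfl

theorem exists_affinePoint (a : K) : ∃ p : AffinePoint K q, p.1.1 = a := by
  have hq := two_le_of_isPrimePow q
  have h := ncard_trace_fiber q (pow_succ_pow_of_card q a)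
  obtain ⟨b, hb⟩ := Set.nonempty_of_ncard_ne_zero (h.trans_ne (by omega))
  exact ⟨⟨(a, b), hb⟩, rfl⟩

theorem card_affinePoint_fiber (a : K) :
    Nat.card {p : AffinePoint K q // p.1.1 = a} = q := by
  refine Eq.trans ?_ (ncard_trace_fiber q (pow_succ_pow_of_card q a))
  rw [← Nat.card_coe_set_eq]
  refine Nat.card_congr
    { toFun := fun p => ⟨p.1.1.2, ?_⟩
      invFun := fun b => ⟨⟨(a, b.1), b.2⟩, rfl⟩
      left_inv := fun p => ?_
      right_inv := fun b => rfl }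
  · have h := p.1.2
    rwa [p.2] at h
  · ext
    · exact p.2.symm
    · rfl

/-- The sum of the orders of a function regular on the affine curve is bounded by means of its norm
`h(x)` to `K(x)`: over each `a` the orders add up to the multiplicity of the root `a` of `h`, and
at infinity the order is minus the degree of `h`. -/
theorem sum_order_nonpos_of_regular {g : HermitianField K q} (hg : g ≠ 0)
    (hreg : ∀ P : Place K (HermitianField K q), P.valuation (hermitianX K q) ≤ 1 →
      P.valuation g ≤ 1) :
    ∑ P : RationalPlace K (HermitianField K q), P.1.order g ≤ 0 := by
  classical
  have hH := isHermitianPair_hermitian K q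
  have hq := two_le_of_isPrimePow q
  have := finite_of_card K q
  have := Fintype.ofFinite K
  obtain ⟨hfin, hgal⟩ := hH.isGalois
  have hx : ∀ ρ : HermitianField K q ≃ₐ[K⟮hermitianX K q⟯] HermitianField K q,
      ρ (hermitianX K q) = hermitianX K q := fun ρ =>
    ρ.commutes (IntermediateField.AdjoinSimple.gen K (hermitianX K q))
  let N := ∏ ρ : HermitianField K q ≃ₐ[K⟮hermitianX K q⟯] HermitianField K q, ρ g
  have hN0 : N ≠ 0 := Finset.prod_ne_zero_iff.2 fun ρ _ => (map_ne_zero ρ).2 hg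
  have hNmem : N ∈ K⟮hermitianX K q⟯ := by
    have := Algebra.norm_eq_prod_automorphisms K⟮hermitianX K q⟯ g
    change _ = N at this
    rw [← this]
    exact (Algebra.norm K⟮hermitianX K q⟯ g).2
  obtain ⟨h, hh⟩ := exists_aeval_eq_of_isIntegral hH.transcendental_left hNmem
    (isIntegral_of_valuation_le_one hH.transcendental_left fun P hP => by
      rw [map_prod]
      refine Finset.prod_le_one' fun ρ _ => hreg (P.comap (ρ.restrictScalars K)) ?_
      rw [Place.comap_valuation]
      change P.valuation (ρ _) ≤ 1
      rwa [hx])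
  have hh0 : h ≠ 0 := by
    rintro rfl
    exact hN0 (by rw [← hh, map_zero])
  have hNord : ∀ P : Place K (HermitianField K q), P.order (aeval (hermitianX K q) h) =
      ∑ ρ : HermitianField K q ≃ₐ[K⟮hermitianX K q⟯] HermitianField K q,
        (P.comap (ρ.restrictScalars K)).order g := fun P => by
    rw [hh, P.order_prod _ _ fun ρ _ => (map_ne_zero ρ).2 hg]
    rfl
  have hfib : ∀ a : K, ∑ p : {p : AffinePoint K q // p.1.1 = a}, (affinePlace p.1).1.order g =
      h.rootMultiplicity a := by
    intro a
    obtain ⟨p₀, rfl⟩ := exists_affinePoint (q := q) a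
    obtain ⟨σ, hσ, hσp⟩ := exists_galois_bijective p₀
    have h1 := hNord (affinePlace p₀).1
    rw [Place.order_aeval_of_const _ (affinePlace_x p₀) hh0, order_hermitianX_sub_self,
      mul_one] at h1
    rw [h1, ← hσ.sum_comp]
    exact Finset.sum_congr rfl fun p _ => by rw [hσp]
  have hinf : (infinitePlace K q).1.order g = -h.natDegree := by
    obtain ⟨p₀, hp₀⟩ := exists_affinePoint (q := q) (0 : K)
    obtain ⟨σ, hσ, -⟩ := exists_galois_bijective p₀
    have hcard : Fintype.card
        (HermitianField K q ≃ₐ[K⟮hermitianX K q⟯] HermitianField K q) = q := by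
      rw [← Nat.card_eq_fintype_card, ← Nat.card_congr (Equiv.ofBijective σ hσ),
        card_affinePoint_fiber]
    have h1 := hNord (infinitePlace K q).1
    rw [Place.order_aeval_of_pole _ one_lt_valuation_hermitianX_infinitePlace hh0,
      order_hermitianX_infinitePlace, Finset.sum_congr rfl fun ρ _ => by
        rw [Place.eq_infinitePlace ((infinitePlace K q).1.comap (ρ.restrictScalars K)) (by
          rw [Place.comap_valuation]
          change 1 < (infinitePlace K q).1.valuation (ρ _)
          rw [hx]
          exact one_lt_valuation_hermitianX_infinitePlace)],
      Finset.sum_const, Finset.card_univ, hcard, nsmul_eq_mul] at h1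
    have hq0 : (q : ℤ) ≠ 0 := by exact_mod_cast (by omega : q ≠ 0)
    refine mul_left_cancel₀ hq0 ?_
    linear_combination -h1
  have haff : ∑ p : AffinePoint K q, (affinePlace p).1.order g =
      ∑ a : K, (h.rootMultiplicity a : ℤ) := by
    rw [← Fintype.sum_fiberwise (fun p : AffinePoint K q => p.1.1)]
    exact Finset.sum_congr rfl fun a _ => hfib a
  have hroots : ∑ a : K, h.rootMultiplicity a ≤ h.natDegree := by
    refine le_trans (le_of_eq ?_) (card_roots' h)
    rw [← Multiset.sum_count_eq_card (s := Finset.univ) fun a _ => Finset.mem_univ a]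
    exact Finset.sum_congr rfl fun a _ => (count_roots h).symm
  rw [sum_rationalPlace (fun P => P.1.order g), hinf, haff]
  have : (∑ a : K, (h.rootMultiplicity a : ℤ)) ≤ h.natDegree := by exact_mod_cast hroots
  omega

/-- A function without nonrational poles has at least as many poles as rational zeros, counted with
multiplicity. Its affine poles are removed by a power of `∏ a, (x - a)`, whose own orders at the
rational places add up to zero. -/
theorem sum_order_nonpos {g : HermitianField K q} (hg : g ≠ 0)
    (hreg : ∀ P : Place K (HermitianField K q), ¬ P.IsRational → P.valuation g ≤ 1) :
    ∑ P : RationalPlace K (HermitianField K q), P.1.order g ≤ 0 := by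
  classical
  have := finite_of_card K q
  have := Fintype.ofFinite K
  -- `u = x ^ (q ^ 2) - x` has a simple zero at each affine rational place.
  let u := ∏ a : K, (hermitianX K q - algebraMap K (HermitianField K q) a)
  have hu0 : u ≠ 0 := Finset.prod_ne_zero_iff.2 fun a _ => hermitianX_sub_ne_zero a
  have huord : ∀ P : Place K (HermitianField K q), P.order u =
      ∑ a : K, P.order (hermitianX K q - algebraMap K (HermitianField K q) a) := fun P =>
    P.order_prod _ _ fun a _ => hermitianX_sub_ne_zero a
  have huaff : ∀ p : AffinePoint K q, (affinePlace p).1.order u = 1 := fun p => by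
    rw [huord, Finset.sum_eq_single p.1.1, order_hermitianX_sub_self]
    · exact fun a _ ha => order_hermitianX_sub_of_ne p ha
    · exact fun h => absurd (Finset.mem_univ _) h
  have huinf : (infinitePlace K q).1.order u = -(q : ℤ) ^ 3 := by
    rw [huord, Finset.sum_congr rfl fun a _ => order_hermitianX_sub_infinitePlace a,
      Finset.sum_const, Finset.card_univ, ← Nat.card_eq_fintype_card, hK.out, nsmul_eq_mul]
    push_cast
    ring
  have husum : ∑ P : RationalPlace K (HermitianField K q), P.1.order u = 0 := by
    rw [sum_rationalPlace (fun P => P.1.order u), huinf, Finset.sum_congr rfl fun p _ => huaff p,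
      Finset.sum_const, Finset.card_univ, card_affinePoint]
    simp
  let n := ∑ p : AffinePoint K q, ((affinePlace p).1.order g).natAbs
  have hn : ∀ p : AffinePoint K q, -(n : ℤ) ≤ (affinePlace p).1.order g := fun p => by
    have : ((affinePlace p).1.order g).natAbs ≤ n :=
      Finset.single_le_sum (f := fun p : AffinePoint K q => ((affinePlace p).1.order g).natAbs)
        (fun _ _ => Nat.zero_le _) (Finset.mem_univ p)
    omega
  have hord : ∀ P : Place K (HermitianField K q), P.order (g * u ^ n) =
      P.order g + n * P.order u := fun P => by
    rw [P.order_mul hg (pow_ne_zero n hu0), P.order_pow]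
  have key := sum_order_nonpos_of_regular (mul_ne_zero hg (pow_ne_zero n hu0)) fun P hP => by
    by_cases hrat : P.IsRational
    · obtain ⟨a, ha⟩ := hrat.exists_const hP
      obtain ⟨p, -, rfl⟩ := P.eq_affinePlace ha
      rw [Place.valuation_le_one_iff _ (mul_ne_zero hg (pow_ne_zero n hu0)), hord, huaff]
      have := hn p
      omega
    · rw [map_mul, map_pow]
      refine mul_le_one' (hreg P hrat) (pow_le_one' ?_ n)
      rw [map_prod]
      exact Finset.prod_le_one' fun a _ =>
        P.valuation.map_sub_le hP (P.valuation_algebraMap_le_one a)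
  rw [Finset.sum_congr rfl fun P _ => hord P.1, Finset.sum_add_distrib, ← Finset.mul_sum, husum,
    mul_zero, add_zero] at key
  exact key

end DegreeBound

/-! ### The minimum distance and the kissing number -/

section Gonality

variable {K : Type*} [Field K] {q : ℕ} [Fact (IsPrimePow q)] [hK : Fact (Nat.card K = q ^ 2)]

open Classical in
/-- A function with rational poles takes each value `c` at no more rational places than its number
of poles, counted with multiplicity, because `f - c` has the same poles as `f`. -/
theorem card_zeros_le_sum_poles {f : HermitianField K q}
    (hreg : ∀ P : Place K (HermitianField K q), ¬ P.IsRational → P.valuation f ≤ 1) {c : K}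
    (hc : f ≠ algebraMap K _ c) :
    ∑ P : RationalPlace K (HermitianField K q),
        (if P.1.valuation (f - algebraMap K _ c) < 1 then 1 else 0 : ℤ) ≤
      ∑ P : RationalPlace K (HermitianField K q), max (-P.1.order f) 0 := by
  have hg : f - algebraMap K _ c ≠ 0 := sub_ne_zero.2 hc
  have h1 := sum_order_nonpos hg fun P hP =>
    P.valuation.map_sub_le (hreg P hP) (P.valuation_algebraMap_le_one c)
  have h2 : ∑ P : RationalPlace K (HermitianField K q),
      (if P.1.valuation (f - algebraMap K _ c) < 1 then 1 else 0 : ℤ) ≤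
      ∑ P : RationalPlace K (HermitianField K q),
        (P.1.order (f - algebraMap K _ c) + max (-P.1.order f) 0) := by
    refine Finset.sum_le_sum fun P _ => ?_
    by_cases hP : P.1.valuation f ≤ 1
    · have h3 := (P.1.valuation_le_one_iff hg).1
        (P.1.valuation.map_sub_le hP (P.1.valuation_algebraMap_le_one c))
      split_ifs with h4
      · have := (P.1.valuation_lt_one_iff hg).1 h4
        omega
      · omega
    · have h3 : P.1.valuation (f - algebraMap K _ c) = P.1.valuation f := by
        refine P.1.valuation.map_sub_eq_of_lt_left ?_
        exact (P.1.valuation_algebraMap_le_one c).trans_lt (not_le.1 hP)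
      have h4 : P.1.order (f - algebraMap K _ c) = P.1.order f := by
        rw [Place.order, h3, Place.order]
      rw [h3, if_neg (fun h => hP h.le), h4]
      omega
  rw [Finset.sum_add_distrib] at h2
  omega

/-- A nonconstant function whose poles are rational has pole degree at least `q`: it takes each of
the `q ^ 2 + 1` values in `K ∪ {∞}` at most as often as its degree, but there are `q ^ 3 + 1`
rational places. -/
theorem le_sum_poles {f : HermitianField K q}
    (hreg : ∀ P : Place K (HermitianField K q), ¬ P.IsRational → P.valuation f ≤ 1)
    (hf : ∀ c : K, f ≠ algebraMap K _ c) :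
    (q : ℤ) ≤ ∑ P : RationalPlace K (HermitianField K q), max (-P.1.order f) 0 := by
  classical
  have := finite_of_card K q
  have := Fintype.ofFinite K
  have hf0 : f ≠ 0 := fun h => hf 0 (by rw [h, map_zero])
  set d := ∑ P : RationalPlace K (HermitianField K q), max (-P.1.order f) 0 with hd
  have h1 : ∑ P : RationalPlace K (HermitianField K q), (1 : ℤ) ≤
      ∑ P : RationalPlace K (HermitianField K q), ((∑ c : K,
        (if P.1.valuation (f - algebraMap K _ c) < 1 then 1 else 0 : ℤ)) +
          max (-P.1.order f) 0) := by
    refine Finset.sum_le_sum fun P _ => ?_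
    by_cases hP : P.1.valuation f ≤ 1
    · obtain ⟨c, hc⟩ := P.2.exists_const hP
      have h2 := Finset.single_le_sum (f := fun c : K =>
        (if P.1.valuation (f - algebraMap K _ c) < 1 then 1 else 0 : ℤ))
        (fun c _ => by split_ifs <;> norm_num) (Finset.mem_univ c)
      simp only [if_pos hc] at h2
      omega
    · rw [P.1.valuation_le_one_iff hf0] at hP
      have h2 : (0 : ℤ) ≤ ∑ c : K,
          (if P.1.valuation (f - algebraMap K _ c) < 1 then 1 else 0 : ℤ) :=
        Finset.sum_nonneg fun c _ => by split_ifs <;> norm_num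
      omega
  rw [Finset.sum_add_distrib, Finset.sum_comm, ← hd, Finset.sum_const, Finset.card_univ,
    card_rationalPlace] at h1
  have h2 := Finset.sum_le_sum fun (c : K) (_ : c ∈ Finset.univ) =>
    card_zeros_le_sum_poles hreg (hf c)
  rw [Finset.sum_const, Finset.card_univ, ← Nat.card_eq_fintype_card, hK.out, ← hd] at h2
  simp only [nsmul_eq_mul] at h1 h2
  push_cast at h1 h2
  by_contra! hlt
  have h3 : ((q : ℤ) ^ 2 + 1) * d ≤ ((q : ℤ) ^ 2 + 1) * (q - 1) :=
    mul_le_mul_of_nonneg_left (by omega) (by positivity)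
  have h4 := Int.le_self_sq (q : ℤ)
  linarith

/-- Both the zeros and the poles of a nonconstant function of `𝒪_𝒫^*` have degree at least `q`, and
`n ^ 2 ≥ |n|` for an integer `n`. -/
theorem two_mul_le_sum_sq {f : HermitianField K q} (hf : f ≠ 0)
    (hreg : ∀ P : Place K (HermitianField K q), ¬ P.IsRational → P.order f = 0)
    (hne : ∃ P : RationalPlace K (HermitianField K q), P.1.order f ≠ 0) :
    2 * (q : ℤ) ≤ ∑ P : RationalPlace K (HermitianField K q), P.1.order f ^ 2 := by
  obtain ⟨P₀, hP₀⟩ := hne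
  have hconst : ∀ c : K, f ≠ algebraMap K _ c := by
    rintro c rfl
    exact hP₀ (P₀.1.order_eq_zero_of_valuation_eq
      (P₀.1.trivial_on_constants c fun h0 => hf (by rw [h0, map_zero])))
  have h1 := le_sum_poles (fun P hP => (P.valuation_le_one_iff hf).2 (hreg P hP).ge) hconst
  have h2 := le_sum_poles (f := f⁻¹)
    (fun P hP => (P.valuation_le_one_iff (inv_ne_zero hf)).2 (by
      rw [Place.order_inv, hreg P hP, neg_zero]))
    (fun c hc => hconst c⁻¹ (by rw [map_inv₀, ← hc, inv_inv]))
  have h3 : ∑ P : RationalPlace K (HermitianField K q),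
      (max (-P.1.order f) 0 + max (-P.1.order f⁻¹) 0) ≤
      ∑ P : RationalPlace K (HermitianField K q), P.1.order f ^ 2 := by
    refine Finset.sum_le_sum fun P _ => ?_
    rw [Place.order_inv, neg_neg]
    rcases le_total 0 (P.1.order f) with h | h
    · rw [max_eq_right (by omega), max_eq_left h]
      nlinarith [Int.le_self_sq (P.1.order f)]
    · rw [max_eq_left (by omega), max_eq_right h]
      nlinarith [Int.le_self_sq (-P.1.order f)]
  rw [Finset.sum_add_distrib] at h3
  omega

theorem mem_hermitianLattice_iff
    {v : EuclideanSpace ℝ (RationalPlace K (HermitianField K q))} :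
    v ∈ hermitianLattice K q ↔ ∃ f : HermitianField K q, f ≠ 0 ∧
      (∀ P : Place K (HermitianField K q), ¬ P.IsRational → P.order f = 0) ∧
      ∀ P, v P = P.1.order f := by
  constructor
  · rintro ⟨f, rfl⟩
    exact ⟨(f.toMul : (HermitianField K q)ˣ), Units.ne_zero _, f.toMul.2, fun P => rfl⟩
  · rintro ⟨f, hf, hreg, hv⟩
    refine ⟨Additive.ofMul ⟨Units.mk0 f hf, hreg⟩, ?_⟩
    ext P
    rw [hv]
    rfl

theorem sqrt_two_mul_le_norm {v : EuclideanSpace ℝ (RationalPlace K (HermitianField K q))}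
    (hv : v ∈ hermitianLattice K q) (hv0 : v ≠ 0) : √(2 * q) ≤ ‖v‖ := by
  obtain ⟨f, hf, hreg, hfv⟩ := mem_hermitianLattice_iff.1 hv
  have h1 := two_mul_le_sum_sq hf hreg (by
    by_contra! h0
    refine hv0 ?_
    ext P
    simp [hfv, h0])
  rw [EuclideanSpace.norm_eq]
  refine Real.sqrt_le_sqrt ?_
  simp_rw [hfv, Real.norm_eq_abs, sq_abs]
  exact_mod_cast h1

theorem finite_lattice_norm_le (r : ℝ) :
    {v | v ∈ hermitianLattice K q ∧ ‖v‖ ≤ r}.Finite := by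
  let g : (RationalPlace K (HermitianField K q) → ℤ) →
      EuclideanSpace ℝ (RationalPlace K (HermitianField K q)) :=
    fun a => WithLp.toLp 2 fun P => (a P : ℝ)
  refine ((Set.Finite.pi' fun _ : RationalPlace K (HermitianField K q) =>
    Set.finite_Icc (-⌈r⌉) ⌈r⌉).image g).subset ?_
  rintro v ⟨hv, hr⟩
  obtain ⟨f, -, -, hfv⟩ := mem_hermitianLattice_iff.1 hv
  refine ⟨fun P => P.1.order f, fun P => ?_, ?_⟩
  · have h1 := (PiLp.norm_apply_le v P).trans (hr.trans (Int.le_ceil r))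
    rw [hfv, Real.norm_eq_abs] at h1
    rw [Set.mem_Icc, ← abs_le]
    exact_mod_cast h1
  · ext P
    exact (hfv P).symm

end Gonality

section Kissing

/-- Two closed balls of radius `d / 2` meet exactly when their centres have distance at most `d`, so
the kissing number counts the minimal vectors. -/
theorem kissingNumber_eq_ncard_minimalVectors {E : Type*} [NormedAddCommGroup E]
    [NormedSpace ℝ E] (L : AddSubgroup E) :
    kissingNumber L = (minimalVectors L).ncard := by
  rw [kissingNumber]
  congr 1
  ext v
  simp only [minimalVectors, Set.mem_ofPred_eq]
  refine and_congr_right fun hv => and_congr_right fun hv0 => ?_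
  have hle : minDist L ≤ ‖v‖ := csInf_le ⟨0, by rintro _ ⟨w, -, -, rfl⟩; exact norm_nonneg w⟩
    ⟨v, hv, hv0, rfl⟩
  constructor
  · rintro ⟨w, hw1, hw2⟩
    rw [Metric.mem_closedBall] at hw1 hw2
    refine le_antisymm ?_ hle
    rw [← dist_zero_right]
    have := dist_triangle_left v 0 w
    linarith
  · intro h
    refine ⟨(2⁻¹ : ℝ) • v, ?_, ?_⟩
    · rw [Metric.mem_closedBall, dist_eq_norm]
      have : (2⁻¹ : ℝ) • v - v = (-2⁻¹ : ℝ) • v := by module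
      rw [this, norm_smul, h]
      norm_num
      linarith
    · rw [Metric.mem_closedBall, dist_zero_right, norm_smul, h]
      norm_num
      linarith

end Kissing

/-! ### Secant lines of the Hermitian curve -/

section Lines

variable (K : Type*) [Field K] (q : ℕ)

/-- The lines of the affine plane over `K` that are not tangent to the Hermitian curve: the
vertical lines `x = a` and the lines `y = m x + k` with `k ^ q + k + m ^ (q + 1) ≠ 0`. -/
inductive SecantLine
  | vertical (a : K)
  | oblique (m k : K) (h : k ^ q + k + m ^ (q + 1) ≠ 0)

variable {K q}

/-- Incidence of a rational point of the projective curve with a line; the point at infinity lies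
on the vertical lines. -/
def SecantLine.Through : SecantLine K q → Option (AffinePoint K q) → Prop
  | vertical _, none => True
  | vertical a, some p => p.1.1 = a
  | oblique _ _ _, none => False
  | oblique m k _, some p => p.1.2 = m * p.1.1 + k

/-- Two points determine a line. -/
theorem SecantLine.eq_of_through {l l' : SecantLine K q} {Q Q' : Option (AffinePoint K q)}
    (hne : Q ≠ Q') (h1 : l.Through Q) (h2 : l.Through Q') (h3 : l'.Through Q)
    (h4 : l'.Through Q') : l = l' := by
  have hpt : ∀ p p' : AffinePoint K q, some p ≠ some p' → p.1.1 = p'.1.1 → p.1.2 ≠ p'.1.2 :=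
    fun p p' h hx hy => h (congrArg some (Subtype.ext (Prod.ext hx hy)))
  rcases l with a | ⟨m, k, hmk⟩ <;> rcases l' with a' | ⟨m', k', hmk'⟩ <;>
    rcases Q with _ | p <;> rcases Q' with _ | p' <;> simp only [Through] at h1 h2 h3 h4
  · exact absurd rfl hne
  · rw [← h2, ← h4]
  · rw [← h1, ← h3]
  · rw [← h1, ← h3]
  · exact absurd (by rw [h3, h4, h1, h2]) (hpt p p' hne (h1.trans h2.symm))
  · exact absurd (by rw [h1, h2, h3, h4]) (hpt p p' hne (h3.trans h4.symm))
  · have hx : p.1.1 - p'.1.1 ≠ 0 := fun h0 =>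
      hpt p p' hne (sub_eq_zero.1 h0) (by rw [h1, h2, sub_eq_zero.1 h0])
    have hm : m = m' := by
      refine mul_right_cancel₀ hx ?_
      linear_combination h2 - h1 + h3 - h4
    subst hm
    have hk : k = k' := by linear_combination h3 - h1
    subst hk
    rfl

variable [Fact (IsPrimePow q)] [hK : Fact (Nat.card K = q ^ 2)]

/-- The equation of the curve, restricted to the line `Y = m X + k`. -/
theorem pow_sub_norm_eq {F : Type*} [Field F] [Algebra K F] (m k : K) (X : F) :
    (X - algebraMap K F m ^ q) ^ (q + 1) -
        algebraMap K F (k ^ q + k + m ^ (q + 1)) =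
      X ^ (q + 1) - ((algebraMap K F m * X + algebraMap K F k) ^ q +
        (algebraMap K F m * X + algebraMap K F k)) := by
  have hm : (algebraMap K F m ^ q) ^ q = algebraMap K F m := by
    rw [← map_pow, ← map_pow, pow_pow_of_card]
  rw [pow_succ (X - _), sub_pow_of_card K q, hm, add_pow_of_card (K := K) q, mul_pow]
  simp only [map_add, map_pow]
  ring

theorem norm_sub_of_mem_line (p : AffinePoint K q) {m k : K} (h : p.1.2 = m * p.1.1 + k) :
    (p.1.1 - m ^ q) ^ (q + 1) = k ^ q + k + m ^ (q + 1) := by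
  have h1 := pow_sub_norm_eq (q := q) m k p.1.1
  simp only [Algebra.algebraMap_self, RingHom.id_apply] at h1
  rw [← h, p.2, sub_self, sub_eq_zero] at h1
  exact h1

theorem SecantLine.card_points (l : SecantLine K q) : Nat.card {Q // l.Through Q} = q + 1 := by
  have := finite_of_card K q
  rcases l with a | ⟨m, k, hmk⟩
  · refine Eq.trans ?_ (congrArg (· + 1) (card_affinePoint_fiber (q := q) a))
    rw [← Finite.card_option]
    refine Nat.card_congr
      { toFun := fun Q => match Q with
          | ⟨none, _⟩ => none
          | ⟨some p, hp⟩ => some ⟨p, hp⟩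
        invFun := fun Q => match Q with
          | none => ⟨none, trivial⟩
          | some p => ⟨some p.1, p.2⟩
        left_inv := ?_
        right_inv := ?_ }
    · rintro ⟨_ | p, hp⟩ <;> rfl
    · rintro (_ | p) <;> rfl
  · have he : (k ^ q + k + m ^ (q + 1)) ^ q = k ^ q + k + m ^ (q + 1) := by
      rw [add_pow_of_card (K := K) q, trace_pow, pow_succ_pow_of_card]
    refine Eq.trans ?_ (ncard_norm_fiber q he hmk)
    rw [← Nat.card_coe_set_eq]
    refine Nat.card_congr
      { toFun := fun Q => match Q with
          | ⟨none, h⟩ => h.elim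
          | ⟨some p, hp⟩ => ⟨p.1.1 - m ^ q, norm_sub_of_mem_line p hp⟩
        invFun := fun z => ⟨some ⟨(z.1 + m ^ q, m * (z.1 + m ^ q) + k), ?_⟩, rfl⟩
        left_inv := ?_
        right_inv := ?_ }
    · have h1 := pow_sub_norm_eq (q := q) m k (z.1 + m ^ q)
      have hz : z.1 ^ (q + 1) = k ^ q + k + m ^ (q + 1) := z.2
      simp only [Algebra.algebraMap_self, RingHom.id_apply, add_sub_cancel_right, hz,
        sub_self] at h1
      exact (sub_eq_zero.1 h1.symm).symm
    · rintro ⟨_ | p, hp⟩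
      · exact hp.elim
      · have hp' : p.1.2 = m * p.1.1 + k := hp
        refine Subtype.ext (congrArg some (Subtype.ext (Prod.ext ?_ ?_)))
        · simp
        · simp [hp']
    · intro z
      simp

open Classical in
/-- The secant lines through a rational point, parametrized by `K`. At an affine point `(a, b)` the
parameter is the slope, the vertical line taking the place of the tangent, which has slope
`a ^ q`. -/
noncomputable def secantLineThrough : Option (AffinePoint K q) → K → SecantLine K q
  | none, c => .vertical c
  | some p, c => if h : c = p.1.1 ^ q then .vertical p.1.1 else
      .oblique c (p.1.2 - c * p.1.1) (by
        rw [← norm_sub_of_mem_line p (m := c) (by ring)]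
        refine pow_ne_zero _ (sub_ne_zero.2 fun h' => h ?_)
        rw [h', pow_pow_of_card])

theorem through_secantLineThrough (Q : Option (AffinePoint K q)) (c : K) :
    (secantLineThrough Q c).Through Q := by
  rcases Q with _ | p
  · trivial
  · rw [secantLineThrough]
    split_ifs
    · rfl
    · simp [SecantLine.Through]

theorem secantLineThrough_injective (Q : Option (AffinePoint K q)) :
    Function.Injective (secantLineThrough Q) := by
  intro c c' h
  rcases Q with _ | p
  · simpa [secantLineThrough] using h
  · rw [secantLineThrough, secantLineThrough] at h
    split_ifs at h with h1 h2 h2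
    · rw [h1, h2]
    · simp only [SecantLine.oblique.injEq] at h
      exact h.1

/-- The linear function that defines a line. -/
noncomputable def SecantLine.function : SecantLine K q → HermitianField K q
  | vertical a => hermitianX K q - algebraMap K _ a
  | oblique m k _ => hermitianY K q - (algebraMap K _ m * hermitianX K q + algebraMap K _ k)

theorem SecantLine.valuation_function_oblique_infinitePlace {m k : K}
    (h : k ^ q + k + m ^ (q + 1) ≠ 0) :
    (infinitePlace K q).1.valuation (oblique m k h).function = WithZero.exp (q + 1 : ℤ) := by
  rw [function, Valuation.map_sub_eq_of_lt_left, valuation_hermitianY_infinitePlace]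
  rw [valuation_hermitianY_infinitePlace]
  have h1 : (infinitePlace K q).1.valuation (algebraMap K _ m * hermitianX K q) ≤
      WithZero.exp (q : ℤ) := by
    rw [map_mul, valuation_hermitianX_infinitePlace]
    exact mul_le_of_le_one_left' (Place.valuation_algebraMap_le_one _ m)
  have h2 : (infinitePlace K q).1.valuation (algebraMap K _ k) ≤ WithZero.exp (q : ℤ) := by
    refine (Place.valuation_algebraMap_le_one _ k).trans ?_
    rw [← WithZero.exp_zero, WithZero.exp_le_exp]
    omega
  refine (Valuation.map_add_le _ h1 h2).trans_lt ?_
  rw [WithZero.exp_lt_exp]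
  omega

theorem SecantLine.function_ne_zero (l : SecantLine K q) : l.function ≠ 0 := by
  rcases l with a | ⟨m, k, h⟩
  · exact hermitianX_sub_ne_zero a
  · intro h0
    have h1 := valuation_function_oblique_infinitePlace h
    rw [h0, map_zero] at h1
    exact WithZero.exp_ne_zero h1.symm

/-- A linear function has no zeros or poles outside the rational places: on its line the equation
of the curve splits into linear factors over `K`. -/
theorem SecantLine.order_function_of_not_isRational (l : SecantLine K q)
    {P : Place K (HermitianField K q)} (hP : ¬ P.IsRational) : P.order l.function = 0 := by
  have hne : ∀ a : K, ¬ P.valuation (hermitianX K q - algebraMap K _ a) < 1 := by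
    intro a ha
    obtain ⟨p, -, rfl⟩ := P.eq_affinePlace ha
    exact hP (affinePlace p).2
  have hx : P.valuation (hermitianX K q) ≤ 1 := by
    by_contra h
    exact hP (P.eq_infinitePlace (not_le.1 h) ▸ (infinitePlace K q).2)
  refine P.order_eq_zero_of_valuation_eq ?_
  rcases l with a | ⟨m, k, hmk⟩
  · exact le_antisymm (P.valuation.map_sub_le hx (P.valuation_algebraMap_le_one a))
      (not_lt.1 (hne a))
  · refine le_antisymm (P.valuation.map_sub_le (P.valuation_hermitianY_le_one hx)
      (P.valuation.map_add_le ?_ (P.valuation_algebraMap_le_one k))) (not_lt.1 fun hlt => ?_)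
    · rw [map_mul]
      exact mul_le_one' (P.valuation_algebraMap_le_one m) hx
    · have he : (k ^ q + k + m ^ (q + 1)) ^ q = k ^ q + k + m ^ (q + 1) := by
        rw [add_pow_of_card (K := K) q, trace_pow, pow_succ_pow_of_card]
      obtain ⟨s, -, hs⟩ := norm_sub_eq_prod he hmk
        (hermitianX K q - algebraMap K (HermitianField K q) m ^ q)
      have hu : (oblique m k hmk).function ^ q + (oblique m k hmk).function =
          ∏ b ∈ s, (hermitianX K q - algebraMap K (HermitianField K q) m ^ q -
            algebraMap K (HermitianField K q) b) := by
        rw [← hs, pow_sub_norm_eq, ← hermitian_equation, function, sub_pow_of_card K q]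
        ring
      obtain ⟨b, -, hb⟩ := P.exists_factor_lt_one (s := s) (by
        rw [← hu]
        refine P.valuation.map_add_lt ?_ hlt
        rw [map_pow]
        exact pow_lt_one₀ zero_le hlt (by have := two_le_of_isPrimePow q; omega))
      refine hne (m ^ q + b) ?_
      rwa [map_add, map_pow, ← sub_sub]

open Classical in
/-- The divisor of a linear function: the sum of the `q + 1` points of the line, minus `q + 1` times
the point at infinity. -/
theorem SecantLine.order_function (l : SecantLine K q) (Q : Option (AffinePoint K q)) :
    (pointEquiv K q Q).1.order l.function =
      (if l.Through Q then 1 else 0) - (if Q = none then (q : ℤ) + 1 else 0) := by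
  have hq := two_le_of_isPrimePow q
  rcases l with a | ⟨m, k, hmk⟩ <;> rcases Q with _ | p
  · simp [Through, function, order_hermitianX_sub_infinitePlace]
  · rw [pointEquiv_some, if_neg (Option.some_ne_none p), sub_zero, function]
    by_cases h : p.1.1 = a
    · rw [if_pos (show (vertical a).Through (some p) from h), ← h, order_hermitianX_sub_self]
    · rw [if_neg (show ¬ (vertical a).Through (some p) from h),
        order_hermitianX_sub_of_ne p (Ne.symm h)]
  · rw [pointEquiv_none,
      Place.order_eq_of_valuation_eq _ (valuation_function_oblique_infinitePlace hmk)]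
    simp [Through]
  · rw [pointEquiv_some, if_neg (Option.some_ne_none p), sub_zero]
    by_cases h : p.1.2 = m * p.1.1 + k
    · rw [if_pos (show (oblique m k hmk).Through (some p) from h)]
      have hm : p.1.1 ^ q - m ≠ 0 := by
        intro h0
        refine hmk ?_
        rw [← norm_sub_of_mem_line p h, ← sub_eq_zero.1 h0, pow_pow_of_card, sub_self,
          zero_pow (by omega)]
      have hform : (oblique m k hmk).function =
          algebraMap K (HermitianField K q) (p.1.1 ^ q - m) *
            (hermitianX K q - algebraMap K _ p.1.1) +
          (hermitianY K q - algebraMap K _ p.1.2 -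
            algebraMap K _ p.1.1 ^ q * (hermitianX K q - algebraMap K _ p.1.1)) := by
        rw [function, h]
        simp only [map_sub, map_pow, map_add, map_mul]
        ring
      have h1 := p.isHermitianPair.valuation_left hq
        (affinePlace p).1 (affinePlace_local p).1 (affinePlace_local p).2
      have h2 := p.isHermitianPair.valuation_right hq
        (affinePlace p).1 (affinePlace_local p).1 (affinePlace_local p).2
      have h3 : (affinePlace p).1.valuation (algebraMap K (HermitianField K q) (p.1.1 ^ q - m) *
          (hermitianX K q - algebraMap K _ p.1.1)) = WithZero.exp (-1 : ℤ) := by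
        rw [map_mul, Place.trivial_on_constants _ _ hm, one_mul, h1]
      rw [Place.order_eq_of_valuation_eq (n := -1), neg_neg]
      rw [hform, Valuation.map_add_eq_of_lt_left, h3]
      rw [h3, h2, WithZero.exp_lt_exp]
      omega
    · rw [if_neg (show ¬ (oblique m k hmk).Through (some p) from h)]
      have h1 : (affinePlace p).1.valuation ((oblique m k hmk).function -
          algebraMap K _ (p.1.2 - (m * p.1.1 + k))) < 1 := by
        have h2 : (oblique m k hmk).function - algebraMap K _ (p.1.2 - (m * p.1.1 + k)) =
            (hermitianY K q - algebraMap K _ p.1.2) -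
              algebraMap K _ m * (hermitianX K q - algebraMap K _ p.1.1) := by
          rw [function]
          simp only [map_sub, map_add, map_mul]
          ring
        rw [h2]
        refine Valuation.map_sub_lt _ (affinePlace_y p) ?_
        rw [mul_comm, map_mul]
        exact mul_lt_one_of_lt_of_le (affinePlace_x p) (Place.valuation_algebraMap_le_one _ m)
      have h2 := (affinePlace p).1.valuation_sub_eq_one h1 (Ne.symm (sub_ne_zero.2 h))
      rw [map_zero, sub_zero] at h2
      exact Place.order_eq_zero_of_valuation_eq _ h2

end Lines

/-! ### Minimal vectors from pairs of lines -/

section MinimalVectors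

variable {K : Type*} [Field K] {q : ℕ} [Fact (IsPrimePow q)] [hK : Fact (Nat.card K = q ^ 2)]

open Classical in
/-- The difference of the indicator vectors of the rational points on two lines; it is the divisor
of the quotient of the two linear functions. -/
noncomputable def lineVector (l l' : SecantLine K q) :
    EuclideanSpace ℝ (RationalPlace K (HermitianField K q)) :=
  WithLp.toLp 2 fun P =>
    (if l.Through ((pointEquiv K q).symm P) then 1 else 0) -
      (if l'.Through ((pointEquiv K q).symm P) then 1 else 0)

open Classical in
theorem lineVector_apply (l l' : SecantLine K q) (Q : Option (AffinePoint K q)) :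
    lineVector l l' (pointEquiv K q Q) =
      (if l.Through Q then 1 else 0) - (if l'.Through Q then 1 else 0) := by
  simp [lineVector]

theorem lineVector_mem (l l' : SecantLine K q) : lineVector l l' ∈ hermitianLattice K q := by
  classical
  have hord : ∀ P : Place K (HermitianField K q), P.order (l.function / l'.function) =
      P.order l.function - P.order l'.function := fun P => by
    rw [div_eq_mul_inv, P.order_mul l.function_ne_zero (inv_ne_zero l'.function_ne_zero),
      P.order_inv, sub_eq_add_neg]
  refine mem_hermitianLattice_iff.2 ⟨l.function / l'.function,
    div_ne_zero l.function_ne_zero l'.function_ne_zero, fun P hP => ?_, fun P => ?_⟩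
  · rw [hord, l.order_function_of_not_isRational hP, l'.order_function_of_not_isRational hP,
      sub_zero]
  · obtain ⟨Q, rfl⟩ := (pointEquiv K q).surjective P
    rw [lineVector_apply, hord, l.order_function, l'.order_function]
    push_cast
    ring

open Classical in
theorem SecantLine.sum_through (l : SecantLine K q) :
    ∑ Q, (if l.Through Q then 1 else 0 : ℝ) = q + 1 := by
  rw [Finset.sum_boole, ← Fintype.card_subtype, ← Nat.card_eq_fintype_card, l.card_points]
  push_cast
  rfl

/-- Two lines that meet in a rational point of the curve have only that point in common, so the
difference of their indicator vectors has `q` entries `1` and `q` entries `-1`. -/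
theorem norm_lineVector {l l' : SecantLine K q} (hne : l ≠ l') {Q : Option (AffinePoint K q)}
    (h : l.Through Q) (h' : l'.Through Q) : ‖lineVector l l'‖ = √(2 * q) := by
  classical
  have hcommon : ∑ R : Option (AffinePoint K q),
      (if l.Through R then 1 else 0 : ℝ) * (if l'.Through R then 1 else 0) = 1 := by
    rw [Finset.sum_eq_single Q]
    · simp [h, h']
    · intro R _ hR
      by_cases h1 : l.Through R <;> by_cases h2 : l'.Through R
      · exact absurd (SecantLine.eq_of_through hR h1 h h2 h') hne
      all_goals simp [h1, h2]
    · exact fun hQ => absurd (Finset.mem_univ _) hQ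
  rw [EuclideanSpace.norm_eq, ← (pointEquiv K q).sum_comp]
  congr 1
  have hterm : ∀ R, ‖lineVector l l' (pointEquiv K q R)‖ ^ 2 =
      (if l.Through R then 1 else 0 : ℝ) + (if l'.Through R then 1 else 0) -
        2 * ((if l.Through R then 1 else 0 : ℝ) * (if l'.Through R then 1 else 0)) := by
    intro R
    rw [lineVector_apply, Real.norm_eq_abs, sq_abs]
    split_ifs <;> norm_num
  rw [Finset.sum_congr rfl fun R _ => hterm R, Finset.sum_sub_distrib, Finset.sum_add_distrib,
    ← Finset.mul_sum, l.sum_through, l'.sum_through, hcommon]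
  ring

/-- A line has `q + 1 ≥ 3` rational points; those outside one given point determine it. -/
theorem SecantLine.exists_two_points (l : SecantLine K q) (Q : Option (AffinePoint K q)) :
    ∃ R S, R ≠ S ∧ R ≠ Q ∧ S ≠ Q ∧ l.Through R ∧ l.Through S := by
  have hq := two_le_of_isPrimePow q
  have h1 : {R | l.Through R}.ncard = q + 1 := by
    rw [← l.card_points, ← Nat.card_coe_set_eq]
    rfl
  have h2 := Set.pred_ncard_le_ncard_sdiff_singleton {R | l.Through R} Q
  obtain ⟨R, S, ⟨hR, hRQ⟩, ⟨hS, hSQ⟩, hRS⟩ :=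
    (Set.one_lt_ncard_iff (Set.toFinite ({R | l.Through R} \ {Q}))).1 (by omega)
  exact ⟨R, S, hRS, hRQ, hSQ, hR, hS⟩

theorem lineVector_swap (l l' : SecantLine K q) : lineVector l' l = -lineVector l l' := by
  ext P
  simp [lineVector]

/-- The positive entries of `lineVector l₁ l₁'` are the points of `l₁` other than the common point,
and they determine `l₁`. -/
theorem eq_of_lineVector_eq {l₁ l₁' l₂ l₂' : SecantLine K q} (hne : l₁ ≠ l₁')
    {Q : Option (AffinePoint K q)} (h : l₁.Through Q) (h' : l₁'.Through Q)
    (heq : lineVector l₁ l₁' = lineVector l₂ l₂') : l₁ = l₂ := by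
  classical
  have hpt : ∀ R, R ≠ Q → l₁.Through R → l₂.Through R := by
    intro R hR h1
    have h2 : ¬ l₁'.Through R := fun h2 => hne (SecantLine.eq_of_through hR h1 h h2 h')
    have h3 := congrArg (fun v : EuclideanSpace ℝ (RationalPlace K (HermitianField K q)) =>
      v (pointEquiv K q R)) heq
    simp only [lineVector_apply, if_pos h1, if_neg h2] at h3
    by_contra h4
    rw [if_neg h4] at h3
    split_ifs at h3 <;> norm_num at h3
  obtain ⟨R, S, hRS, hR, hS, h1, h2⟩ := l₁.exists_two_points Q
  exact SecantLine.eq_of_through hRS h1 h2 (hpt R hR h1) (hpt S hS h2)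

variable (K q) in
theorem minDist_hermitianLattice : minDist (hermitianLattice K q) = √(2 * q) := by
  have h01 : secantLineThrough (K := K) (q := q) none 0 ≠ secantLineThrough none 1 :=
    (secantLineThrough_injective none).ne zero_ne_one
  have hnorm := norm_lineVector h01 (through_secantLineThrough none 0)
    (through_secantLineThrough none 1)
  have hq := two_le_of_isPrimePow q
  refine le_antisymm (csInf_le ⟨0, by rintro _ ⟨w, -, -, rfl⟩; exact norm_nonneg w⟩
    ⟨_, lineVector_mem _ _, ?_, hnorm⟩) (le_csInf ⟨_, _, lineVector_mem _ _, ?_, hnorm⟩ ?_)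
  · rw [← norm_ne_zero_iff, hnorm]
    positivity
  · rw [← norm_ne_zero_iff, hnorm]
    positivity
  · rintro _ ⟨v, hv, hv0, rfl⟩
    exact sqrt_two_mul_le_norm hv hv0

variable (K q) in
/-- The `(q ^ 3 + 1) (q ^ 4 - q ^ 2)` ordered pairs of distinct secant lines through a common
rational point give distinct minimal vectors. -/
theorem le_ncard_minimalVectors :
    (q ^ 3 + 1) * (q ^ 2 * q ^ 2 - q ^ 2) ≤ (minimalVectors (hermitianLattice K q)).ncard := by
  classical
  have := finite_of_card K q
  have := Fintype.ofFinite K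
  have hq := two_le_of_isPrimePow q
  let T : Finset (Option (AffinePoint K q) × (K × K)) :=
    Finset.univ ×ˢ (Finset.univ : Finset K).offDiag
  let w : Option (AffinePoint K q) × (K × K) →
      EuclideanSpace ℝ (RationalPlace K (HermitianField K q)) :=
    fun s => lineVector (secantLineThrough s.1 s.2.1) (secantLineThrough s.1 s.2.2)
  have hTcard : T.card = (q ^ 3 + 1) * (q ^ 2 * q ^ 2 - q ^ 2) := by
    rw [Finset.card_product, Finset.offDiag_card, Finset.card_univ, Finset.card_univ,
      Fintype.card_option, card_affinePoint, ← Nat.card_eq_fintype_card, hK.out]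
  have hT : ∀ s ∈ T, secantLineThrough s.1 s.2.1 ≠ secantLineThrough s.1 s.2.2 := by
    intro s hs h
    have h1 : s.2.1 ≠ s.2.2 := by simpa [T] using hs
    exact h1 (secantLineThrough_injective s.1 h)
  have hfin : (minimalVectors (hermitianLattice K q)).Finite :=
    (finite_lattice_norm_le (minDist (hermitianLattice K q))).subset
      fun v hv => ⟨hv.1, hv.2.2.le⟩
  rw [← hTcard, ← Set.ncard_coe_finset T]
  refine Set.ncard_le_ncard_of_injOn w (fun s hs => ?_) (fun s hs s' hs' h => ?_) hfin
  · have hnorm := norm_lineVector (hT s hs) (through_secantLineThrough s.1 s.2.1)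
      (through_secantLineThrough s.1 s.2.2)
    refine ⟨lineVector_mem _ _, ?_, by rw [minDist_hermitianLattice]; exact hnorm⟩
    rw [← norm_ne_zero_iff]
    refine ne_of_eq_of_ne hnorm ?_
    positivity
  · obtain ⟨Q, c, d⟩ := s
    obtain ⟨Q', c', d'⟩ := s'
    have h1 : secantLineThrough Q c = secantLineThrough Q' c' :=
      eq_of_lineVector_eq (hT _ hs) (through_secantLineThrough Q c)
        (through_secantLineThrough Q d) h
    have h2 : secantLineThrough Q d = secantLineThrough Q' d' :=
      eq_of_lineVector_eq (hT _ hs).symm (through_secantLineThrough Q d)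
        (through_secantLineThrough Q c) (by
          rw [lineVector_swap, lineVector_swap (secantLineThrough Q' c')]
          exact congrArg _ h)
    have hQ : Q = Q' := by
      by_contra hne
      exact hT _ hs (SecantLine.eq_of_through hne (through_secantLineThrough Q c)
        (h1 ▸ through_secantLineThrough Q' c') (through_secantLineThrough Q d)
        (h2 ▸ through_secantLineThrough Q' d'))
    subst hQ
    rw [secantLineThrough_injective Q h1, secantLineThrough_injective Q h2]

end MinimalVectors

end FunctionFieldLattice

theorem mainTheorem4 {K : Type*} [Field K] (q : ℕ) [Fact (IsPrimePow q)]
    [Fact (Nat.card K = q ^ 2)] :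
    (q : ℤ) ^ 7 - (q : ℤ) ^ 5 + (q : ℤ) ^ 4 - (q : ℤ) ^ 2 ≤
        ((FunctionFieldLattice.minimalVectors
          (FunctionFieldLattice.hermitianLattice K q)).ncard : ℤ) ∧
      (q : ℤ) ^ 7 - (q : ℤ) ^ 5 + (q : ℤ) ^ 4 - (q : ℤ) ^ 2 ≤
        (FunctionFieldLattice.kissingNumber
          (FunctionFieldLattice.hermitianLattice K q) : ℤ) := by
  rw [FunctionFieldLattice.kissingNumber_eq_ncard_minimalVectors, and_self]
  have h := FunctionFieldLattice.le_ncard_minimalVectors K q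
  have h1 : q ^ 2 ≤ q ^ 2 * q ^ 2 := Nat.le_mul_self _
  zify [h1] at h
  linarith
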